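/- \textbf{Setting.} Let $\mathbb T=\mathbb R/\mathbb Z$ and let $L^2(\mathbb T)$ be the space of square integrable real $1$-periodic functions. Let $\Lambda(x)=2x\,\mathbf 1_{[0,1/2)}(x)+2(1-x)\,\mathbf 1_{[1/2,1]}(x)$, and for $j\ge 0$, $1\le k\le 2^j$ put $\psi_{j,k}(x)=\Lambda(2^jx-k+1)$; put $\psi_1(x)=\big(\psi_{0,1}(x-\tfrac12)+\psi_{0,1}(x+\tfrac12)\big)\mathbf 1_{[0,1]}(x)$. Write $\psi_i=\psi_{j,k}$ for $i=2^j+k$, extend the $\psi_i$ $(i\ge1)$ from $[0,1)$ to $1$-periodic functions, and let $\ell(1)=\ell(2)=0$ and $\ell(i)=j$ for $2^j+1\le i\le 2^{j+1}$. Let $\mathcal I_r=\{i:\ell(i)\le r\}=\{1,\dots,2^{r+1}\}$ and let $\mathscr C_r$ be the linear span of $\{\psi_i: i\in\mathcal I_r\}$. For a set $A$ and an (extended) semimetric $\rho$, let $N(\varepsilon,A,\rho)$ be the minimal number of $\rho$-balls of radius $\varepsilon$ needed to cover $A$; $\log 0=-\infty$. \textbf{Smoothness of $b_0$.} Let $\beta\in(0,\infty)$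 and $b_0=\sum_{i\ge1}z_i\psi_i$ with $\sup_{i\ge1}2^{\beta\ell(i)}|z_i|<\infty$. \textbf{Prior.} Let $b^{R,S}=S\sum_{i\in\mathcal I_R}Z_i\psi_i$, where the sequence $Z=(Z_i)_{i\ge1}$, the random level $R\in\{0,1,2,\dots\}$ and the real random variable $S$ are independent, $Z$ is centred Gaussian with covariances $A_{ii'}=\operatorname{Cov}(Z_i,Z_{i'})$, and: (i) either (A) $\alpha>0$ is fixed, $A_{ii}=2^{-2\alpha\ell(i)}$ for all $i$ and $A_{ii'}=0$ for $i\ne i'$; or (B) there are $0<c_1<c_2$ and $c_3>0$ with $3c_3<c_1$ such that $c_12^{-\ell(i)}\le A_{ii}\le c_22^{-\ell(i)}$ for all $i$ and $|A_{ii'}|\le c_32^{-1.5(\ell(i)+\ell(i'))}$ for all $i\neq i'$, and in this case $\alpha:=\tfrac12$; (ii) there are $c_1',c_2'>0$ with $\mathbb P(R>r)\le\exp(-c_1'2^rr)$ and $\mathbb P(R=r)\ge\exp(-c_2'2^rr)$ for all integers $r\ge1$; (iii) there are $0<p_1<p_2$, $q>0$ and $C>1$ with $p_1>q|\alpha-\beta|$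 such that $\mathbb P(S\in[x^{p_1},x^{p_2}])\ge\exp(-x^q)$ for all $x\ge C$. \textbf{Theorem.} Let $(\varepsilon_n)$ be a sequence of positive numbers that converges to zero. There is a constant $C_1>0$ such that for every $C_2>0$ there are measurable sets $\mathscr B_n\subseteq L^2(\mathbb T)$, each of which can be taken to be one of the spaces $\mathscr C_r$, such that for every $a>0$ there is a constant $C_3>0$ such that for all sufficiently large $n$ \begin{align*} \log\mathbb P\big(\|b^{R,S}-b_0\|_\infty<\varepsilon_n\big)&\ge -C_1\varepsilon_n^{-1/\beta}|\log\varepsilon_n|,\\ \log\mathbb P\big(b^{R,S}\notin\mathscr B_n\big)&\le -C_2\varepsilon_n^{-1/\beta}|\log\varepsilon_n|,\\ \log N\big(a\varepsilon_n,\{b\in\mathscr B_n:\|b-b_0\|_2\le\varepsilon_n\},\|\cdot\|_\infty\big)&\le C_3\varepsilon_n^{-1/\beta}|\log\varepsilon_n|. \end{align*} -/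

import Mathlib

open MeasureTheory ProbabilityTheory Filter Topology
open scoped ENNReal

namespace FaberSchauder

noncomputable section

/-! ### The Faber-Schauder functions -/

/-- The hat function `Λ`. -/
def hat (x : ℝ) : ℝ :=
  if 0 ≤ x ∧ x < 1 / 2 then 2 * x else if 1 / 2 ≤ x ∧ x ≤ 1 then 2 * (1 - x) else 0

/-- `ψ_{j,k}(x) = Λ(2^j x - k + 1)`. -/
def psiJK (j k : ℕ) (x : ℝ) : ℝ := hat (2 ^ j * x - k + 1)

/-- `ψ_1(x) = (ψ_{0,1}(x - 1/2) + ψ_{0,1}(x + 1/2)) 1_{[0,1]}(x)`. -/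
def psiOne (x : ℝ) : ℝ :=
  if 0 ≤ x ∧ x ≤ 1 then psiJK 0 1 (x - 1 / 2) + psiJK 0 1 (x + 1 / 2) else 0

/-- The level `ℓ(i)` of the single index `i ≥ 1`: `0` for `i = 1, 2`, and `j` for
`2^j + 1 ≤ i ≤ 2^(j+1)`. -/
def level (i : ℕ+) : ℕ := Nat.log 2 ((i : ℕ) - 1)

theorem level_one : level 1 = 0 := by simp [level]

theorem level_eq {i : ℕ+} {j : ℕ} (h₁ : 2 ^ j + 1 ≤ (i : ℕ)) (h₂ : (i : ℕ) ≤ 2 ^ (j + 1)) :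
    level i = j := by
  unfold level
  have := Nat.one_le_two_pow (n := j)
  exact (Nat.log_eq_iff (Or.inr ⟨by norm_num, by omega⟩)).2 ⟨by omega, by omega⟩

/-- The function `ψ_i` on the real line: `ψ_1` for `i = 1`, and `ψ_{j,k}` for `i = 2^j + k` with
`1 ≤ k ≤ 2^j`. -/
def psi (i : ℕ+) : ℝ → ℝ :=
  if i = 1 then psiOne else psiJK (level i) ((i : ℕ) - 2 ^ level i)

theorem hat_eq (x : ℝ) : hat x = max 0 (1 - |2 * x - 1|) := by
  unfold hat
  split_ifs with h₁ h₂
  · rw [abs_of_nonpos (by linarith [h₁.2]), max_eq_right (by linarith [h₁.1])]; ring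
  · rw [abs_of_nonneg (by linarith [h₂.1]), max_eq_right (by linarith [h₂.2])]; ring
  · rw [max_eq_left]
    by_cases hx : x < 1 / 2
    · have : x < 0 := by
        by_contra h
        exact h₁ ⟨not_lt.1 h, hx⟩
      linarith [neg_le_abs (2 * x - 1)]
    · have : 1 < x := by
        by_contra h
        exact h₂ ⟨not_lt.1 hx, not_lt.1 h⟩
      linarith [le_abs_self (2 * x - 1)]

theorem continuous_hat : Continuous hat := by
  have : hat = fun x => max 0 (1 - |2 * x - 1|) := funext hat_eq
  rw [this]; fun_prop

theorem continuous_psiJK (j k : ℕ) : Continuous (psiJK j k) := by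
  have := continuous_hat
  unfold psiJK
  fun_prop

theorem continuousOn_psi (i : ℕ+) : ContinuousOn (psi i) (Set.Icc 0 (0 + 1)) := by
  unfold psi
  split_ifs with h
  · have h' : Continuous fun x : ℝ => psiJK 0 1 (x - 1 / 2) + psiJK 0 1 (x + 1 / 2) := by
      have := continuous_psiJK 0 1
      fun_prop
    refine h'.continuousOn.congr fun x hx => ?_
    rw [zero_add] at hx
    simp [psiOne, hx.1, hx.2]
  · exact (continuous_psiJK _ _).continuousOn

theorem psi_zero_eq (i : ℕ+) : psi i 0 = psi i (0 + 1) := by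
  unfold psi
  split_ifs with h
  · norm_num [psiOne, psiJK, hat]
  · have hi : 2 ≤ (i : ℕ) := by
      have h1 : (i : ℕ) ≠ 1 := fun h' => h (PNat.coe_eq_one_iff.1 h')
      have := i.pos
      omega
    have h1 : 2 ^ level i ≤ (i : ℕ) - 1 := Nat.pow_log_le_self 2 (by omega)
    have h2 : (i : ℕ) - 1 < 2 ^ (level i + 1) := Nat.lt_pow_succ_log_self (by norm_num) _
    obtain ⟨k, hk⟩ : ∃ k, k = (i : ℕ) - 2 ^ level i := ⟨_, rfl⟩
    have hk1 : 1 ≤ k := by omega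
    have hk2 : k ≤ 2 ^ level i := by rw [pow_succ] at h2; omega
    rw [← hk]
    have hk1' : (1 : ℝ) ≤ k := by exact_mod_cast hk1
    have hk2' : (k : ℝ) ≤ 2 ^ level i := by exact_mod_cast hk2
    simp only [psiJK, hat_eq]
    rw [max_eq_left, max_eq_left]
    · have := le_abs_self (2 * ((2 : ℝ) ^ level i * (0 + 1) - k + 1) - 1)
      linarith
    · have := neg_le_abs (2 * ((2 : ℝ) ^ level i * 0 - k + 1) - 1)
      linarith

/-- The 1-periodic extension of `ψ_i` restricted to `[0,1)`, a continuous function on the circle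
`𝕋 = ℝ/ℤ`. -/
def psiCircle (i : ℕ+) : C(UnitAddCircle, ℝ) :=
  ⟨AddCircle.liftIco 1 0 (psi i), AddCircle.liftIco_continuous (psi_zero_eq i) (continuousOn_psi i)⟩

/-! ### The space `L²(𝕋)` -/

/-- `L²(𝕋)`: square integrable 1-periodic real functions. -/
abbrev L2T : Type := Lp ℝ 2 (volume : Measure UnitAddCircle)

/-- `ψ_i` as an element of `L²(𝕋)`. -/
def psiL2 (i : ℕ+) : L2T := ContinuousMap.toLp 2 volume ℝ (psiCircle i)

/-- The (essential) supremum norm `‖f‖_∞`, possibly infinite, of `f ∈ L²(𝕋)`. -/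
def supNorm (f : L2T) : ℝ≥0∞ := eLpNorm f ∞ volume

/-- The covering number `N(ε, A, ρ)`: the minimal number of (open) `ρ`-balls of radius `ε` needed to
cover `A`; it is `⊤` if finitely many do not suffice. -/
def coveringNumber {X : Type*} (ρ : X → X → ℝ≥0∞) (ε : ℝ) (A : Set X) : ℕ∞ :=
  sInf {N : ℕ∞ | ∃ t : Finset X, N = (t.card : ℕ∞) ∧ ∀ x ∈ A, ∃ y ∈ t, ρ x y < ENNReal.ofReal ε}

/-- The index set `I_r = {1, …, 2^(r+1)}` of the basis functions of level at most `r`. -/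
def indexSet (r : ℕ) : Finset ℕ+ := Finset.Icc 1 (2 ^ (r + 1))

/-- The linear span of the Faber-Schauder functions of level at most `r`. -/
def levelSpan (r : ℕ) : Submodule ℝ L2T := Submodule.span ℝ (psiL2 '' (indexSet r : Set ℕ+))

theorem mem_indexSet_iff {r : ℕ} {i : ℕ+} : i ∈ indexSet r ↔ level i ≤ r := by
  have hc : i ∈ indexSet r ↔ (i : ℕ) ≤ 2 ^ (r + 1) := by
    rw [indexSet, Finset.mem_Icc, ← PNat.coe_le_coe i]
    simp
  rw [hc, level]
  have hi := i.pos
  constructor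
  · intro h
    exact Nat.lt_succ_iff.1 (Nat.log_lt_of_lt_pow' (by omega) (by omega))
  · intro h
    have := Nat.lt_pow_succ_log_self (b := 2) (by norm_num) ((i : ℕ) - 1)
    have := Nat.pow_le_pow_right (n := 2) (by norm_num) (Nat.succ_le_succ h)
    simp only [Nat.succ_eq_add_one] at this
    omega

/-! ### Smoothness of the true function, and the prior -/

/-- `b₀ = ∑_{i ≥ 1} z_i ψ_i` with `sup_i 2^{β ℓ(i)} |z_i| < ∞`. -/
def IsSmooth (β : ℝ) (b₀ : L2T) : Prop :=
  ∃ z : ℕ+ → ℝ, HasSum (fun i => z i • psiL2 i) b₀ ∧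
    BddAbove (Set.range fun i => (2 : ℝ) ^ (β * level i) * |z i|)

/-- Covariance condition (A), with parameter `α`. -/
def CovA (α : ℝ) (A : ℕ+ → ℕ+ → ℝ) : Prop :=
  (∀ i, A i i = (2 : ℝ) ^ (-2 * α * level i)) ∧ ∀ i i', i ≠ i' → A i i' = 0

/-- Covariance condition (B). -/
def CovB (A : ℕ+ → ℕ+ → ℝ) : Prop :=
  ∃ c₁ c₂ c₃ : ℝ, 0 < c₁ ∧ c₁ < c₂ ∧ 0 < c₃ ∧ 3 * c₃ < c₁ ∧
    (∀ i, c₁ * (2 : ℝ) ^ (-(level i : ℝ)) ≤ A i i ∧ A i i ≤ c₂ * (2 : ℝ) ^ (-(level i : ℝ))) ∧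
    ∀ i i', i ≠ i' → |A i i'| ≤ c₃ * (2 : ℝ) ^ (-(1.5 : ℝ) * ((level i : ℝ) + level i'))

variable {Ω : Type*} [MeasurableSpace Ω]

/-- Condition on the prior of the truncation level. -/
def TruncationCond (P : Measure Ω) (R : Ω → ℕ) : Prop :=
  ∃ c₁ c₂ : ℝ, 0 < c₁ ∧ 0 < c₂ ∧ ∀ r : ℕ, 1 ≤ r →
    P.real {ω | r < R ω} ≤ Real.exp (-c₁ * 2 ^ r * r) ∧
    Real.exp (-c₂ * 2 ^ r * r) ≤ P.real {ω | R ω = r}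

/-- Condition on the prior of the scaling factor, relative to `α` and `β`. -/
def ScalingCond (P : Measure Ω) (S : Ω → ℝ) (α β : ℝ) : Prop :=
  ∃ p₁ p₂ q C : ℝ, 0 < p₁ ∧ p₁ < p₂ ∧ 0 < q ∧ 1 < C ∧ q * |α - β| < p₁ ∧
    ∀ x : ℝ, C ≤ x → Real.exp (-x ^ q) ≤ P.real {ω | S ω ∈ Set.Icc (x ^ p₁) (x ^ p₂)}

/-- The random function `b^{R,S} = S ∑_{i ∈ I_R} Z_i ψ_i`, with values in `L²(𝕋)`. -/
def prior (Z : ℕ+ → Ω → ℝ) (R : Ω → ℕ) (S : Ω → ℝ) (ω : Ω) : L2T :=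
  S ω • ∑ i ∈ indexSet (R ω), Z i ω • psiL2 i

/-- The rate `ε^{-1/β} |log ε|`. -/
def rate (β ε : ℝ) : ℝ := ε ^ (-1 / β) * |Real.log ε|

end

end FaberSchauder

/-!
The prior leaves the span of the Faber-Schauder functions of level at most `r` with probability at
most `exp(-c 2^r r)`, its truncation level equals `r` with probability at least `exp(-C 2^r r)`, and
a `β`-smooth function is approximated uniformly by this span with error of order `2^{-β r}`.
Balancing `2^{-β r}` against `ε` gives `2^r` of order `ε^{-1/β}` and `r` of order `|log ε|`, so that
all three estimates reduce to bounds in terms of `2^r r`.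

*Small balls* (`exists_exp_le_measure_ball`). Functions `ψ_i` of equal level have essentially
disjoint supports, hence it suffices to approximate each of the `2^{r+1}` coefficients up to
`2^{-β r} / r`, for a fixed scaling `s` between `2^{|α-β| r}` and a power of `2^r`. Such an `s` has
the required prior probability because `q |α - β| < p₁`. The coefficients may be dependent, but in
both cases (A) and (B) their covariance matrix dominates a diagonal matrix with comparable diagonal
(`exists_posSemidef_sub`), where in case (B) `3 c₃ < c₁` makes the off-diagonal part small in
Hilbert-Schmidt norm. The Gaussian vector is therefore a sum `W + G` of independent parts with `G`
having independent coordinates. Given `W`, the box probability is a product of one-dimensional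
ones, and Jensen's inequality takes care of the average over `W` (`ofReal_prod_le_measure_box`).
Each coordinate then costs a factor exponential in `r`.

*Remaining mass.* The prior leaves the span up to level `r` only if `R > r`; taking `2^r` a large
multiple of `ε^{-1/β}` makes this as unlikely as required.

*Entropy* (`coveringNumber_levelSpan_le`). The elements of this span are affine on dyadic intervals
of length `2^{-(r+1)}`, so their values at the `2^{r+1} + 1` nodes are bounded by a multiple of
`2^r` times their `L²` norm, and these values determine the uniform norm. Rounding the node values
produces a cover of cardinality `(C 2^r)^{2^{r+1} + 1}`.
-/

namespace FaberSchauder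

/-! ### Lower bounds for Gaussian boxes -/

/-- The bound comes from `x ^ 2 ≤ 2 (w ^ 2 + δ ^ 2)` on the interval. -/
theorem ofReal_le_gaussianReal_Icc {v : NNReal} (hv : v ≠ 0) (w δ : ℝ) :
    ENNReal.ofReal (2 * δ / √(2 * Real.pi * v) * Real.exp (-(w ^ 2 + δ ^ 2) / v)) ≤
      gaussianReal 0 v (Set.Icc (w - δ) (w + δ)) := by
  have hv' : (0 : ℝ) < v := by positivity
  rw [gaussianReal_apply _ hv]
  calc ENNReal.ofReal (2 * δ / √(2 * Real.pi * v) * Real.exp (-(w ^ 2 + δ ^ 2) / v))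
      = ∫⁻ _ in Set.Icc (w - δ) (w + δ),
          ENNReal.ofReal ((√(2 * Real.pi * v))⁻¹ * Real.exp (-(w ^ 2 + δ ^ 2) / v)) := by
        rw [setLIntegral_const, Real.volume_Icc, ← ENNReal.ofReal_mul (by positivity)]
        congr 1
        ring
    _ ≤ _ := by
        refine setLIntegral_mono (measurable_gaussianPDF 0 v) fun x hx => ?_
        refine ENNReal.ofReal_le_ofReal ?_
        rw [gaussianPDFReal]
        refine mul_le_mul_of_nonneg_left (Real.exp_le_exp.2 ?_) (by positivity)
        rw [sub_zero, neg_div, neg_div, neg_le_neg_iff, div_le_div_iff₀ (by positivity) hv']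
        have h : (x - w) ^ 2 ≤ δ ^ 2 := by
          apply sq_le_sq'
          · linarith [hx.1]
          · linarith [hx.2]
        have : x ^ 2 ≤ (w ^ 2 + δ ^ 2) * 2 := by nlinarith [sq_nonneg (x - 2 * w)]
        nlinarith

section Box

variable {Ω ι : Type*} [MeasurableSpace Ω] [Fintype ι] [DecidableEq ι]

/-- If the covariance matrix `A` of a centred Gaussian vector dominates the diagonal matrix with
entries `v i`, then the vector is distributed as the sum of two independent centred Gaussian
vectors, with covariance matrices `A - diagonal v` and `diagonal v`. -/
theorem map_eq_conv_of_posSemidef_sub {P : Measure Ω} [IsProbabilityMeasure P] {X : ι → Ω → ℝ}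
    (hX : HasGaussianLaw (fun ω i => X i ω) P) (hmean : ∀ i, ∫ ω, X i ω ∂P = 0)
    {v : ι → NNReal}
    (hpsd : (Matrix.of (fun i j => cov[X i, X j; P]) -
      Matrix.diagonal fun i => (v i : ℝ)).PosSemidef) :
    P.map (fun ω => WithLp.toLp 2 fun i => X i ω) =
      (multivariateGaussian 0 (Matrix.of (fun i j => cov[X i, X j; P]) -
          Matrix.diagonal fun i => (v i : ℝ))) ∗
        ((Measure.pi fun i => gaussianReal 0 (v i)).map (WithLp.toLp 2)) := by
  have hm : ∀ i, Integrable (X i) P := fun i => (hX.eval i).integrable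
  have hL := hX.toLp_pi 2
  have hG : IsGaussian (P.map (fun ω => WithLp.toLp 2 fun i => X i ω)) := hL.isGaussian_map
  have hprob : IsProbabilityMeasure
      ((Measure.pi fun i => gaussianReal 0 (v i)).map (WithLp.toLp 2)) :=
    Measure.isProbabilityMeasure_map (by fun_prop)
  refine Measure.ext_of_charFun (funext fun t => ?_)
  rw [charFun_conv, charFun_pi, IsGaussian.charFun_eq', charFun_multivariateGaussian hpsd,
    covarianceBilin_apply_pi fun i => (hX.eval i).memLp_two]
  have h0 : ∫ x, id x ∂(P.map (fun ω => WithLp.toLp 2 fun i => X i ω)) = 0 := by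
    rw [integral_map hL.aemeasurable (by fun_prop)]
    ext i
    have := (EuclideanSpace.proj (𝕜 := ℝ) i).integral_comp_comm hL.integrable
    simp only [EuclideanSpace.coe_proj] at this
    simp only [id]
    rw [← this]
    simpa using hmean i
  rw [h0]
  simp only [charFun_gaussianReal, ← Complex.exp_sum, ← Complex.exp_add]
  congr 1
  simp only [inner_zero_right, Complex.ofReal_zero, zero_mul, zero_sub, mul_zero,
    Matrix.sub_mulVec, dotProduct_sub, Finset.sum_neg_distrib]
  have h1 : (t.ofLp ⬝ᵥ (Matrix.diagonal fun i => (v i : ℝ)).mulVec t.ofLp : ℝ) =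
      ∑ i, v i * t.ofLp i ^ 2 := by
    simp only [dotProduct, Matrix.mulVec_diagonal]
    exact Finset.sum_congr rfl fun i _ => by ring
  have h2 : (t.ofLp ⬝ᵥ (Matrix.of fun i j => cov[X i, X j; P]).mulVec t.ofLp : ℝ) =
      ∑ i, ∑ j, t.ofLp i * t.ofLp j * cov[X i, X j; P] := by
    simp only [dotProduct, Matrix.mulVec, Matrix.of_apply, Finset.mul_sum]
    exact Finset.sum_congr rfl fun i _ => Finset.sum_congr rfl fun j _ => by ring
  rw [h1, h2]
  push_cast
  rw [← Finset.sum_div]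
  ring

/-- A lower bound for the probability that a centred Gaussian vector lies in a small box, when its
covariance matrix `A` dominates the diagonal matrix with entries `v i` and its variances are at most
`c * v i`. By `map_eq_conv_of_posSemidef_sub` the vector is `W + G` with `G` having independent
coordinates of variances `v i`; given `W` the probability is a product, and Jensen's inequality
removes the dependence on `W`. -/
theorem ofReal_prod_le_measure_box {P : Measure Ω} [IsProbabilityMeasure P] {X : ι → Ω → ℝ}
    (hX : HasGaussianLaw (fun ω i => X i ω) P) (hmean : ∀ i, ∫ ω, X i ω ∂P = 0)
    {v : ι → NNReal} (hv : ∀ i, v i ≠ 0)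
    (hpsd : (Matrix.of (fun i j => cov[X i, X j; P]) -
      Matrix.diagonal fun i => (v i : ℝ)).PosSemidef)
    {c : ℝ} (hc : ∀ i, cov[X i, X i; P] ≤ c * v i) (w : ι → ℝ) {δ : ℝ} (hδ : 0 < δ) :
    ENNReal.ofReal ((∏ i, (2 * δ / √(2 * Real.pi * v i) *
        Real.exp (-(2 * w i ^ 2 + δ ^ 2) / v i))) * Real.exp (-(2 * c * Fintype.card ι))) ≤
      P {ω | ∀ i, |X i ω - w i| ≤ δ} := by
  set B := Matrix.of (fun i j => cov[X i, X j; P]) - Matrix.diagonal fun i => (v i : ℝ) with hB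
  set μ := multivariateGaussian (0 : EuclideanSpace ℝ ι) B with hμ
  set ν := Measure.pi fun i => gaussianReal 0 (v i) with hν
  set K : ℝ := ∏ i, (2 * δ / √(2 * Real.pi * v i) * Real.exp (-(2 * w i ^ 2 + δ ^ 2) / v i))
    with hK
  have hvpos : ∀ i, (0 : ℝ) < v i := fun i => by have := hv i; positivity
  have hK0 : 0 ≤ K := Finset.prod_nonneg fun i _ => by have := hvpos i; positivity
  have hL := hX.toLp_pi 2
  let E : Set (EuclideanSpace ℝ ι) := {x | ∀ i, |x i - w i| ≤ δ}
  have hE : MeasurableSet E := by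
    have : E = ⋂ i, {x : EuclideanSpace ℝ ι | |x i - w i| ≤ δ} := by
      ext x; simp [E]
    rw [this]
    refine MeasurableSet.iInter fun i => measurableSet_le ?_ measurable_const
    fun_prop
  have hPE : P {ω | ∀ i, |X i ω - w i| ≤ δ} =
      P.map (fun ω => WithLp.toLp 2 fun i => X i ω) E := by
    rw [Measure.map_apply_of_aemeasurable hL.aemeasurable hE]
    rfl
  have hconv : (μ ∗ (ν.map (WithLp.toLp 2))) E =
      ∫⁻ y, ∏ i, gaussianReal 0 (v i) (Set.Icc (w i - y i - δ) (w i - y i + δ)) ∂μ := by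
    have hprob : IsProbabilityMeasure (ν.map (WithLp.toLp 2)) :=
      Measure.isProbabilityMeasure_map (by fun_prop)
    have hE' : MeasurableSet
        ((fun x : EuclideanSpace ℝ ι × EuclideanSpace ℝ ι => x.1 + x.2) ⁻¹' E) :=
      (measurable_fst.add measurable_snd) hE
    rw [Measure.conv, Measure.map_apply (by fun_prop) hE, Measure.prod_apply hE']
    refine lintegral_congr fun y => ?_
    rw [Measure.map_apply (by fun_prop) (measurable_prodMk_left hE'), hν, ← Measure.pi_pi]
    congr 1
    ext g
    simp only [E, Set.mem_preimage, Set.mem_ofPred_eq, Set.mem_univ_pi, Set.mem_Icc, abs_le]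
    refine forall_congr' fun i => ?_
    simp only [PiLp.add_apply]
    constructor <;> rintro ⟨h1, h2⟩ <;> constructor <;> linarith
  have hpoint : ∀ y : EuclideanSpace ℝ ι,
      ENNReal.ofReal (K * Real.exp (-∑ i, 2 * y i ^ 2 / v i)) ≤
        ∏ i, gaussianReal 0 (v i) (Set.Icc (w i - y i - δ) (w i - y i + δ)) := by
    intro y
    rw [hK, ← Finset.sum_neg_distrib, Real.exp_sum, ← Finset.prod_mul_distrib,
      ENNReal.ofReal_prod_of_nonneg fun i _ => by have := hvpos i; positivity]
    refine Finset.prod_le_prod' fun i _ => le_trans (ENNReal.ofReal_le_ofReal ?_)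
      (ofReal_le_gaussianReal_Icc (hv i) (w i - y i) δ)
    rw [mul_assoc, ← Real.exp_add]
    refine mul_le_mul_of_nonneg_left (Real.exp_le_exp.2 ?_) (by positivity)
    rw [← sub_eq_add_neg, div_sub_div_same]
    refine (div_le_div_iff_of_pos_right (hvpos i)).2 ?_
    nlinarith [sq_nonneg (w i + y i)]
  have hmem : ∀ i, MemLp (fun y : EuclideanSpace ℝ ι => y i) 2 μ := fun i =>
    (IsGaussian.memLp_two_id (μ := μ)).continuousLinearMap_comp (EuclideanSpace.proj (𝕜 := ℝ) i)
  have hmean0 : ∀ i, ∫ y, y i ∂μ = 0 := fun i => by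
    have := (EuclideanSpace.proj (𝕜 := ℝ) i).integral_comp_comm (μ := μ) (φ := fun y => y)
      IsGaussian.integrable_fun_id
    simpa [hμ] using this
  have hsq : ∀ i, ∫ y, y i ^ 2 ∂μ = cov[X i, X i; P] - v i := fun i => by
    have h := variance_eval_multivariateGaussian (μ := 0) hpsd i
    rw [← hμ, variance_of_integral_eq_zero (hmem i).aemeasurable (hmean0 i)] at h
    rw [h, hB]
    simp
  have hint : ∀ i, Integrable (fun y : EuclideanSpace ℝ ι => 2 * y i ^ 2 / v i) μ := fun i =>
    ((hmem i).integrable_sq.const_mul 2).div_const _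
  have hIle : ∫ y, ∑ i, 2 * y i ^ 2 / v i ∂μ ≤ 2 * c * Fintype.card ι := by
    rw [integral_finsetSum _ fun i _ => hint i, mul_comm _ (Fintype.card ι : ℝ), ← nsmul_eq_mul,
      ← Finset.card_univ]
    refine Finset.sum_le_card_nsmul _ _ _ fun i _ => ?_
    rw [integral_div, integral_const_mul, hsq, div_le_iff₀ (hvpos i)]
    have := hc i
    have := hvpos i
    nlinarith
  have hexpint : Integrable (fun y : EuclideanSpace ℝ ι =>
      Real.exp (-∑ i, 2 * y i ^ 2 / v i)) μ := by
    refine Integrable.of_bound (C := 1) (by fun_prop) (ae_of_all _ fun y => ?_)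
    rw [Real.norm_eq_abs, abs_of_pos (Real.exp_pos _), Real.exp_le_one_iff, neg_nonpos]
    exact Finset.sum_nonneg fun i _ => by have := hvpos i; positivity
  have hJ : Real.exp (-(2 * c * Fintype.card ι)) ≤
      ∫ y, Real.exp (-∑ i, 2 * y i ^ 2 / v i) ∂μ := by
    refine le_trans (Real.exp_le_exp.2 (neg_le_neg hIle)) ?_
    rw [← integral_neg]
    exact convexOn_exp.map_integral_le Real.continuous_exp.continuousOn isClosed_univ
      (by simp) (integrable_finsetSum _ fun i _ => hint i).neg hexpint
  rw [hPE, map_eq_conv_of_posSemidef_sub hX hmean hpsd, hconv]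
  refine le_trans ?_ (lintegral_mono hpoint)
  rw [← ofReal_integral_eq_lintegral_ofReal (hexpint.const_mul K)
    (ae_of_all _ fun y => by positivity), integral_const_mul]
  exact ENNReal.ofReal_le_ofReal (mul_le_mul_of_nonneg_left hJ hK0)

end Box

/-! ### Faber-Schauder sums on the circle -/

theorem psiCircle_coe (i : ℕ+) {x : ℝ} (h0 : 0 ≤ x) (h1 : x < 1) :
    psiCircle i (x : UnitAddCircle) = psi i x :=
  AddCircle.liftIco_coe_apply ⟨h0, by simpa using h1⟩

theorem exists_coe_eq (y : UnitAddCircle) : ∃ x : ℝ, 0 ≤ x ∧ x < 1 ∧ (x : UnitAddCircle) = y := by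
  obtain ⟨x, hx, rfl⟩ : y ∈ ((↑) : ℝ → UnitAddCircle) '' Set.Ico 0 (0 + 1) := by
    rw [AddCircle.coe_image_Ico_eq]; trivial
  exact ⟨x, hx.1, by simpa using hx.2, rfl⟩

theorem hat_nonneg (x : ℝ) : 0 ≤ hat x := by
  rw [hat_eq]; exact le_max_left _ _

theorem hat_le_one (x : ℝ) : hat x ≤ 1 := by
  rw [hat_eq]
  exact max_le zero_le_one (by linarith [abs_nonneg (2 * x - 1)])

theorem hat_ne_zero {x : ℝ} (h : hat x ≠ 0) : 0 < x ∧ x < 1 := by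
  rw [hat_eq] at h
  have h' : 0 < 1 - |2 * x - 1| := by
    by_contra h''
    exact h (max_eq_left (not_lt.1 h''))
  have := abs_lt.1 (sub_pos.1 h')
  constructor <;> linarith

theorem psi_of_ne_one {i : ℕ+} (hi : i ≠ 1) (x : ℝ) :
    psi i x = hat (2 ^ level i * x - ((i : ℕ) - 2 ^ level i : ℕ) + 1) := by
  rw [psi, if_neg hi, psiJK]

theorem two_pow_level_lt {i : ℕ+} (hi : i ≠ 1) : 2 ^ level i < (i : ℕ) := by
  have h1 : (i : ℕ) ≠ 1 := fun h' => hi (PNat.coe_eq_one_iff.1 h')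
  have := i.pos
  have : 2 ^ level i ≤ (i : ℕ) - 1 := Nat.pow_log_le_self 2 (by omega)
  omega

/-- On `[0, 1]` the function `ψ_1` equals `|2x - 1|`. -/
theorem psi_one_eq {x : ℝ} (h0 : 0 ≤ x) (h1 : x ≤ 1) : psi 1 x = |2 * x - 1| := by
  rw [psi, if_pos rfl, psiOne, if_pos ⟨h0, h1⟩]
  have e1 : psiJK 0 1 (x - 1 / 2) = hat (x - 1 / 2) := by simp [psiJK]
  have e2 : psiJK 0 1 (x + 1 / 2) = hat (x + 1 / 2) := by simp [psiJK]
  rw [e1, e2, hat_eq, hat_eq]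
  rcases le_total x (1 / 2) with h | h
  · rw [abs_of_nonpos (by linarith : 2 * (x - 1 / 2) - 1 ≤ 0),
      abs_of_nonneg (by linarith : 0 ≤ 2 * (x + 1 / 2) - 1), abs_of_nonpos (by linarith),
      max_eq_left (by linarith), max_eq_right (by linarith)]
    ring
  · rw [abs_of_nonpos (by linarith : 2 * (x - 1 / 2) - 1 ≤ 0),
      abs_of_nonneg (by linarith : 0 ≤ 2 * (x + 1 / 2) - 1), abs_of_nonneg (by linarith),
      max_eq_right (by linarith), max_eq_left (by linarith)]
    ring

theorem abs_psi_le_one (i : ℕ+) {x : ℝ} (h0 : 0 ≤ x) (h1 : x ≤ 1) : |psi i x| ≤ 1 := by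
  by_cases hi : i = 1
  · rw [hi, psi_one_eq h0 h1, abs_abs, abs_le]
    constructor <;> linarith
  · rw [psi_of_ne_one hi, abs_of_nonneg (hat_nonneg _)]
    exact hat_le_one _

/-- The indices of the basis functions of level exactly `j`. -/
def levelIndex (j : ℕ) : Finset ℕ+ := (indexSet j).filter (level · = j)

theorem mem_levelIndex {i : ℕ+} {j : ℕ} : i ∈ levelIndex j ↔ level i = j := by
  rw [levelIndex, Finset.mem_filter, mem_indexSet_iff]
  exact ⟨fun h => h.2, fun h => ⟨h.le, h⟩⟩

theorem sum_indexSet {M : Type*} [AddCommMonoid M] (f : ℕ+ → M) (r : ℕ) :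
    ∑ i ∈ indexSet r, f i = ∑ j ∈ Finset.range (r + 1), ∑ i ∈ levelIndex j, f i := by
  rw [← Finset.sum_fiberwise_of_maps_to (g := level) (t := Finset.range (r + 1))
    (fun i hi => Finset.mem_range_succ_iff.2 (mem_indexSet_iff.1 hi))]
  refine Finset.sum_congr rfl fun j hj => Finset.sum_congr ?_ fun _ _ => rfl
  ext i
  rw [Finset.mem_filter, mem_levelIndex, mem_indexSet_iff]
  exact ⟨fun h => h.2, fun h => ⟨h ▸ Finset.mem_range_succ_iff.1 hj, h⟩⟩

theorem card_indexSet (r : ℕ) : (indexSet r).card = 2 ^ (r + 1) := by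
  rw [indexSet, PNat.card_Icc]
  simp

/-- Functions `ψ_i` of the same level have disjoint supports, except for the pair `ψ_1`, `ψ_2` of
level zero. -/
theorem sum_abs_psi_le_two (j : ℕ) {x : ℝ} (h0 : 0 ≤ x) (h1 : x ≤ 1) :
    ∑ i ∈ levelIndex j, |psi i x| ≤ 2 := by
  have hcard : (((levelIndex j).erase 1).filter fun i => psi i x ≠ 0).card ≤ 1 := by
    refine Finset.card_le_one.2 fun a ha b hb => ?_
    simp only [Finset.mem_filter, Finset.mem_erase, mem_levelIndex] at ha hb
    obtain ⟨⟨ha1, haj⟩, hax⟩ := ha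
    obtain ⟨⟨hb1, hbj⟩, hbx⟩ := hb
    rw [psi_of_ne_one ha1] at hax
    rw [psi_of_ne_one hb1] at hbx
    have hax' := hat_ne_zero hax
    have hbx' := hat_ne_zero hbx
    have hal := two_pow_level_lt ha1
    have hbl := two_pow_level_lt hb1
    rw [haj] at hax' hal
    rw [hbj] at hbx' hbl
    have e1 : ((a : ℕ) - 2 ^ j : ℕ) < ((b : ℕ) - 2 ^ j : ℕ) + 1 := by
      have : (((a : ℕ) - 2 ^ j : ℕ) : ℝ) < (((b : ℕ) - 2 ^ j : ℕ) : ℝ) + 1 := by linarith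
      exact_mod_cast this
    have e2 : ((b : ℕ) - 2 ^ j : ℕ) < ((a : ℕ) - 2 ^ j : ℕ) + 1 := by
      have : (((b : ℕ) - 2 ^ j : ℕ) : ℝ) < (((a : ℕ) - 2 ^ j : ℕ) : ℝ) + 1 := by linarith
      exact_mod_cast this
    exact PNat.eq (by omega)
  have hrest : ∑ i ∈ (levelIndex j).erase 1, |psi i x| ≤ 1 := by
    rw [← Finset.sum_filter_of_ne (p := fun i => psi i x ≠ 0)
      (fun i _ h => fun h' => h (by rw [h', abs_zero]))]
    refine (Finset.sum_le_card_nsmul _ _ 1 fun i _ => abs_psi_le_one i h0 h1).trans ?_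
    rw [nsmul_eq_mul, mul_one]
    exact_mod_cast hcard
  by_cases h : (1 : ℕ+) ∈ levelIndex j
  · rw [← Finset.add_sum_erase _ _ h]
    linarith [abs_psi_le_one 1 h0 h1]
  · rw [Finset.erase_eq_of_notMem h] at hrest
    linarith

theorem norm_sum_levelIndex_le (j : ℕ) (c : ℕ+ → ℝ) {m : ℝ} (hm : ∀ i, level i = j → |c i| ≤ m) :
    ‖∑ i ∈ levelIndex j, c i • psiCircle i‖ ≤ 2 * m := by
  have hm0 : 0 ≤ m := by
    have hj : level (⟨2 ^ j + 1, by positivity⟩ : ℕ+) = j :=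
      level_eq (j := j) (by simp) (by
        have := Nat.one_le_two_pow (n := j)
        simp only [PNat.mk_coe, pow_succ]; omega)
    exact (abs_nonneg _).trans (hm _ hj)
  refine (ContinuousMap.norm_le _ (by positivity)).2 fun y => ?_
  obtain ⟨x, h0, h1, rfl⟩ := exists_coe_eq y
  simp only [ContinuousMap.coe_sum, ContinuousMap.coe_smul, Finset.sum_apply, Pi.smul_apply,
    smul_eq_mul, psiCircle_coe _ h0 h1, Real.norm_eq_abs]
  calc |∑ i ∈ levelIndex j, c i * psi i x| ≤ ∑ i ∈ levelIndex j, |c i * psi i x| :=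
        Finset.abs_sum_le_sum_abs _ _
    _ ≤ ∑ i ∈ levelIndex j, m * |psi i x| := by
        refine Finset.sum_le_sum fun i hi => ?_
        rw [abs_mul]
        exact mul_le_mul_of_nonneg_right (hm i (mem_levelIndex.1 hi)) (abs_nonneg _)
    _ ≤ 2 * m := by
        rw [← Finset.mul_sum, mul_comm]
        exact mul_le_mul_of_nonneg_right (sum_abs_psi_le_two j h0 h1.le) hm0

theorem norm_sum_indexSet_le (r : ℕ) (c : ℕ+ → ℝ) {m : ℝ} (hm : ∀ i ∈ indexSet r, |c i| ≤ m) :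
    ‖∑ i ∈ indexSet r, c i • psiCircle i‖ ≤ 2 * (r + 1) * m := by
  rw [sum_indexSet]
  refine (norm_sum_le_of_le (f := fun j => ∑ i ∈ levelIndex j, c i • psiCircle i)
    (n := fun _ => 2 * m) _ fun j hj => ?_).trans (le_of_eq ?_)
  · exact norm_sum_levelIndex_le j c fun i hi =>
      hm i (mem_indexSet_iff.2 (hi ▸ Finset.mem_range_succ_iff.1 hj))
  · simp; ring

/-- The continuous linear embedding of continuous functions into `L²(𝕋)`. -/
noncomputable def toL2 : C(UnitAddCircle, ℝ) →L[ℝ] L2T := ContinuousMap.toLp 2 volume ℝ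

theorem toL2_psiCircle (i : ℕ+) : toL2 (psiCircle i) = psiL2 i := rfl

theorem supNorm_toL2_le (f : C(UnitAddCircle, ℝ)) : supNorm (toL2 f) ≤ ENNReal.ofReal ‖f‖ := by
  have h : toL2 f =ᵐ[volume] f := ContinuousMap.coeFn_toLp volume f
  rw [supNorm, eLpNorm_congr_ae h, eLpNorm_exponent_top]
  exact eLpNormEssSup_le_of_ae_bound (ae_of_all _ f.norm_coe_le_norm)

/-- A function with coefficients `|z i| ≤ M 2^{-β ℓ(i)}` has a continuous version, approximated
uniformly by its partial sums at rate `2^{-β r}`. -/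
theorem exists_continuous_version {β : ℝ} (hβ : 0 < β) {b₀ : L2T} {z : ℕ+ → ℝ}
    (hz : HasSum (fun i => z i • psiL2 i) b₀) {M : ℝ}
    (hM : ∀ i, |z i| ≤ M * (2 : ℝ) ^ (-β * level i)) :
    ∃ f : C(UnitAddCircle, ℝ), toL2 f = b₀ ∧ ∃ D : ℝ, ∀ r : ℕ,
      ‖f - ∑ i ∈ indexSet r, z i • psiCircle i‖ ≤ D * (2 : ℝ) ^ (-β * r) := by
  set ρ : ℝ := (2 : ℝ) ^ (-β) with hρ
  have hρ0 : 0 < ρ := by positivity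
  have hρ1 : ρ < 1 := Real.rpow_lt_one_of_one_lt_of_neg (by norm_num) (by linarith)
  have hpow : ∀ j : ℕ, (2 : ℝ) ^ (-β * j) = ρ ^ j := fun j => by
    rw [hρ, ← Real.rpow_mul_natCast (by norm_num)]
  simp only [hpow] at hM ⊢
  let g : ℕ → C(UnitAddCircle, ℝ) := fun j => ∑ i ∈ levelIndex j, z i • psiCircle i
  have hg : ∀ j, ‖g j‖ ≤ 2 * M * ρ ^ j := fun j => by
    rw [mul_assoc]
    exact norm_sum_levelIndex_le j z fun i hi => hi ▸ hM i
  have hgs : Summable g :=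
    Summable.of_norm_bounded ((summable_geometric_of_lt_one hρ0.le hρ1).mul_left _) hg
  have hpart : ∀ r, ∑ i ∈ indexSet r, z i • psiCircle i = ∑ j ∈ Finset.range (r + 1), g j :=
    fun r => sum_indexSet _ r
  refine ⟨∑' j, g j, ?_, 2 * M * ρ * (1 - ρ)⁻¹, fun r => ?_⟩
  · have hI : Tendsto indexSet atTop atTop := by
      refine tendsto_atTop_finset_of_monotone (fun a b hab i hi => ?_) fun i => ⟨level i, ?_⟩
      · exact mem_indexSet_iff.2 ((mem_indexSet_iff.1 hi).trans hab)
      · exact mem_indexSet_iff.2 le_rfl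
    have h1 : Tendsto (fun r => ∑ i ∈ indexSet r, z i • psiL2 i) atTop (𝓝 b₀) := hz.comp hI
    have h2 : Tendsto (fun r => toL2 (∑ j ∈ Finset.range (r + 1), g j)) atTop
        (𝓝 (toL2 (∑' j, g j))) :=
      (toL2.continuous.tendsto _).comp
        ((tendsto_add_atTop_iff_nat 1).2 hgs.hasSum.tendsto_sum_nat)
    refine tendsto_nhds_unique h2 (h1.congr fun r => ?_)
    rw [← hpart, map_sum]
    exact Finset.sum_congr rfl fun i _ => by rw [map_smul, toL2_psiCircle]
  · rw [hpart, ← hgs.sum_add_tsum_nat_add (r + 1), add_sub_cancel_left]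
    have hs : HasSum (fun j : ℕ => 2 * M * ρ * ρ ^ r * ρ ^ j) (2 * M * ρ * ρ ^ r * (1 - ρ)⁻¹) :=
      (hasSum_geometric_of_lt_one hρ0.le hρ1).mul_left _
    refine (tsum_of_norm_bounded hs fun j => (hg _).trans (le_of_eq ?_)).trans (le_of_eq ?_)
    · ring
    · ring

/-! ### Metric entropy of the spaces spanned up to a level -/

/-- The hat function is affine between consecutive half-integers. -/
theorem exists_hat_eq_affine (n : ℤ) :
    ∃ p q : ℝ, ∀ x : ℝ, (n : ℝ) ≤ 2 * x → 2 * x ≤ n + 1 → hat x = p * x + q := by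
  rcases lt_trichotomy n 0 with h | rfl | h
  · have h' : (n : ℝ) + 1 ≤ 0 := by exact_mod_cast h
    refine ⟨0, 0, fun x _ h2 => ?_⟩
    rw [hat_eq, abs_of_nonpos (by linarith), max_eq_left (by linarith)]
    ring
  · refine ⟨2, 0, fun x h1 h2 => ?_⟩
    push_cast at h1 h2
    rw [hat_eq, abs_of_nonpos (by linarith), max_eq_right (by linarith)]
    ring
  · rcases (Int.add_one_le_iff.2 h).eq_or_lt with h3 | h3
    · obtain rfl : n = 1 := by omega
      refine ⟨-2, 2, fun x h1 h2 => ?_⟩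
      push_cast at h1 h2
      rw [hat_eq, abs_of_nonneg (by linarith), max_eq_right (by linarith)]
      ring
    · have h' : (2 : ℝ) ≤ n := by exact_mod_cast h3
      refine ⟨0, 0, fun x h1 _ => ?_⟩
      rw [hat_eq, abs_of_nonneg (by linarith), max_eq_left (by linarith)]
      ring

/-- The functions on the circle that are affine on the dyadic intervals of length `2^{-(r+1)}`. -/
def dyadicAffine (r : ℕ) : Submodule ℝ C(UnitAddCircle, ℝ) where
  carrier := {f | ∀ m : ℕ, m < 2 ^ (r + 1) → ∃ p q : ℝ, ∀ x : ℝ, (m : ℝ) ≤ 2 ^ (r + 1) * x →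
    2 ^ (r + 1) * x ≤ m + 1 → f (x : UnitAddCircle) = p * x + q}
  zero_mem' := fun m _ => ⟨0, 0, fun x _ _ => by simp⟩
  add_mem' := fun {f g} hf hg m hm => by
    obtain ⟨p, q, h⟩ := hf m hm
    obtain ⟨p', q', h'⟩ := hg m hm
    refine ⟨p + p', q + q', fun x h1 h2 => ?_⟩
    rw [ContinuousMap.add_apply, h x h1 h2, h' x h1 h2]
    ring
  smul_mem' := fun c f hf m hm => by
    obtain ⟨p, q, h⟩ := hf m hm
    refine ⟨c * p, c * q, fun x h1 h2 => ?_⟩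
    rw [ContinuousMap.smul_apply, h x h1 h2, smul_eq_mul]
    ring

theorem psiCircle_coe_of_le (i : ℕ+) {x : ℝ} (h0 : 0 ≤ x) (h1 : x ≤ 1) :
    psiCircle i (x : UnitAddCircle) = psi i x := by
  rcases h1.lt_or_eq with h | rfl
  · exact psiCircle_coe i h0 h
  · have : ((1 : ℝ) : UnitAddCircle) = ((0 : ℝ) : UnitAddCircle) := by
      rw [AddCircle.coe_period, QuotientAddGroup.mk_zero]
    rw [this, psiCircle_coe i le_rfl zero_lt_one, psi_zero_eq, zero_add]

theorem psiCircle_mem_dyadicAffine {r : ℕ} {i : ℕ+} (hi : level i ≤ r) :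
    psiCircle i ∈ dyadicAffine r := by
  intro m hm
  have hp : (0 : ℝ) < 2 ^ (r + 1) := by positivity
  have hm' : (m : ℝ) + 1 ≤ 2 ^ (r + 1) := by exact_mod_cast hm
  have hx : ∀ x : ℝ, (m : ℝ) ≤ 2 ^ (r + 1) * x → 2 ^ (r + 1) * x ≤ m + 1 → 0 ≤ x ∧ x ≤ 1 := by
    intro x h1 h2
    constructor
    · by_contra h
      have := mul_neg_of_pos_of_neg hp (not_le.1 h)
      have : (0 : ℝ) ≤ m := Nat.cast_nonneg m
      linarith
    · by_contra h
      have := mul_lt_mul_of_pos_left (not_le.1 h) hp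
      linarith
  by_cases h1 : i = 1
  · rw [h1]
    have h2 : (2 : ℝ) ^ (r + 1) = 2 * 2 ^ r := by ring
    have hp' : (0 : ℝ) < 2 ^ r := by positivity
    by_cases hmr : m < 2 ^ r
    · have hmr' : (m : ℝ) + 1 ≤ 2 ^ r := by exact_mod_cast hmr
      refine ⟨-2, 1, fun x hx1 hx2 => ?_⟩
      rw [psiCircle_coe_of_le 1 (hx x hx1 hx2).1 (hx x hx1 hx2).2,
        psi_one_eq (hx x hx1 hx2).1 (hx x hx1 hx2).2, abs_of_nonpos]
      · ring
      · rw [h2] at hx2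
        have : 2 ^ r * (2 * x - 1) ≤ 0 := by linarith
        by_contra h
        linarith [mul_pos hp' (not_le.1 h)]
    · have hmr' : (2 : ℝ) ^ r ≤ m := by exact_mod_cast not_lt.1 hmr
      refine ⟨2, -1, fun x hx1 hx2 => ?_⟩
      rw [psiCircle_coe_of_le 1 (hx x hx1 hx2).1 (hx x hx1 hx2).2,
        psi_one_eq (hx x hx1 hx2).1 (hx x hx1 hx2).2, abs_of_nonneg]
      · ring
      · rw [h2] at hx1
        have : 0 ≤ 2 ^ r * (2 * x - 1) := by linarith
        by_contra h
        linarith [mul_neg_of_pos_of_neg hp' (not_le.1 h)]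
  · obtain ⟨d, rfl⟩ := Nat.exists_eq_add_of_le hi
    set j := level i with hj
    set k := ((i : ℕ) - 2 ^ j : ℕ) with hk
    -- the dyadic interval lies in `[n / 2^{j+1}, (n+1) / 2^{j+1}]`
    set n := m / 2 ^ d with hn
    have hd : (0 : ℝ) < 2 ^ d := by positivity
    have hn1 : (n : ℝ) * 2 ^ d ≤ m := by exact_mod_cast Nat.div_mul_le_self m (2 ^ d)
    have hn2 : (m : ℝ) + 1 ≤ (n + 1) * 2 ^ d := by
      have : m < 2 ^ d * (n + 1) := Nat.lt_mul_div_succ m (by positivity)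
      rw [mul_comm] at this
      exact_mod_cast this
    obtain ⟨p, q, h⟩ := exists_hat_eq_affine ((n : ℤ) - 2 * k + 2)
    refine ⟨p * 2 ^ j, q + p * (1 - k), fun x hx1 hx2 => ?_⟩
    have e : (2 : ℝ) ^ (j + d + 1) * x = 2 * (2 ^ j * x) * 2 ^ d := by ring
    rw [psiCircle_coe_of_le i (hx x hx1 hx2).1 (hx x hx1 hx2).2, psi_of_ne_one h1, h]
    · ring
    · push_cast
      have : (n : ℝ) ≤ 2 * (2 ^ j * x) := le_of_mul_le_mul_right (by linarith) hd
      linarith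
    · push_cast
      have : 2 * (2 ^ j * x) ≤ (n : ℝ) + 1 := le_of_mul_le_mul_right (by linarith) hd
      linarith

theorem exists_mem_dyadicAffine {r : ℕ} {b : L2T} (hb : b ∈ levelSpan r) :
    ∃ f ∈ dyadicAffine r, toL2 f = b := by
  have h : levelSpan r ≤ (dyadicAffine r).map (toL2 : C(UnitAddCircle, ℝ) →ₗ[ℝ] L2T) := by
    refine Submodule.span_le.2 ?_
    rintro _ ⟨i, hi, rfl⟩
    exact ⟨psiCircle i, psiCircle_mem_dyadicAffine (mem_indexSet_iff.1 hi), rfl⟩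
  exact h hb

/-- The node `m / 2^{r+1}` on the circle; `m = 0` and `m = 2^{r+1}` give the same
point. -/
noncomputable def node (r : ℕ) (m : ℕ) : UnitAddCircle := ((m / 2 ^ (r + 1) : ℝ) : UnitAddCircle)

theorem norm_le_of_nodes {r : ℕ} {f : C(UnitAddCircle, ℝ)} (hf : f ∈ dyadicAffine r) {K : ℝ}
    (hK : ∀ m ≤ 2 ^ (r + 1), |f (node r m)| ≤ K) : ‖f‖ ≤ K := by
  have hp : (0 : ℝ) < 2 ^ (r + 1) := by positivity
  refine (ContinuousMap.norm_le _ ((abs_nonneg _).trans (hK 0 (Nat.zero_le _)))).2 fun y => ?_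
  obtain ⟨x, h0, h1, rfl⟩ := exists_coe_eq y
  set m := ⌊2 ^ (r + 1) * x⌋₊ with hm
  have hm1 : (m : ℝ) ≤ 2 ^ (r + 1) * x := Nat.floor_le (by positivity)
  have hm2 : 2 ^ (r + 1) * x < m + 1 := Nat.lt_floor_add_one _
  have hlt : m < 2 ^ (r + 1) := by
    have : (m : ℝ) < 2 ^ (r + 1) := by nlinarith
    exact_mod_cast this
  obtain ⟨p, q, h⟩ := hf m hlt
  have hu := hK m hlt.le
  have hv := hK (m + 1) hlt
  have hc : ∀ c : ℝ, 2 ^ (r + 1) * (c / 2 ^ (r + 1)) = c := fun c => by field_simp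
  rw [node, h _ (hc _).ge (by rw [hc]; linarith)] at hu
  rw [node, h _ (by rw [hc]; push_cast; linarith) (by rw [hc]; push_cast; linarith)] at hv
  rw [h x hm1 hm2.le, Real.norm_eq_abs]
  push_cast at hv
  set t : ℝ := 2 ^ (r + 1) * x - m with ht
  -- the value at `x` is a convex combination of the values at the neighbouring nodes
  have hx : p * x + q = (1 - t) * (p * (m / 2 ^ (r + 1)) + q) +
      t * (p * ((m + 1) / 2 ^ (r + 1)) + q) := by
    rw [ht]; field_simp; ring
  rw [hx]
  rw [abs_le] at hu hv ⊢
  have ht0 : 0 ≤ t := by linarith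
  have ht1 : 0 ≤ 1 - t := by linarith
  constructor <;> nlinarith

theorem norm_toL2_sq (f : C(UnitAddCircle, ℝ)) : ‖toL2 f‖ ^ 2 = ∫ x : ℝ in (0 : ℝ)..1,
    f (x : UnitAddCircle) ^ 2 := by
  have h := ContinuousMap.inner_toLp (𝕜 := ℝ) (volume : Measure UnitAddCircle) f f
  have h' := UnitAddCircle.intervalIntegral_preimage 0 fun y => f y ^ 2
  rw [zero_add] at h'
  rw [h', ← real_inner_self_eq_norm_sq]
  refine h.trans (integral_congr_ae (ae_of_all _ fun x => ?_))
  simp [sq]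

theorem integral_affine_sq (a h u s : ℝ) :
    ∫ x in a..a + h, (u + s * (x - a)) ^ 2 =
      h / 3 * (u ^ 2 + u * (u + s * h) + (u + s * h) ^ 2) := by
  rw [intervalIntegral.integral_eq_sub_of_hasDerivAt
    (f := fun x => u ^ 2 * (x - a) + u * s * (x - a) ^ 2 + s ^ 2 * (x - a) ^ 3 / 3)]
  · simp only [add_sub_cancel_left, sub_self]
    ring
  · intro x _
    have h1 : HasDerivAt (fun x : ℝ => x - a) 1 x := (hasDerivAt_id x).sub_const a
    have := ((h1.const_mul (u ^ 2)).add ((h1.pow 2).const_mul (u * s))).add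
      (((h1.pow 3).const_mul (s ^ 2)).div_const 3)
    refine this.congr_deriv ?_
    norm_num
    ring
  · exact Continuous.intervalIntegrable (by fun_prop) _ _

/-- An inverse inequality: node values are controlled by the `L²` norm, since on an interval of
length `h` an affine function with end values `u`, `v` has squared norm `h (u² + uv + v²) / 3`. -/
theorem sq_node_le {r : ℕ} {f : C(UnitAddCircle, ℝ)} (hf : f ∈ dyadicAffine r) {m : ℕ}
    (hm : m ≤ 2 ^ (r + 1)) : f (node r m) ^ 2 ≤ 6 * 2 ^ (r + 1) * ‖toL2 f‖ ^ 2 := by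
  have hp : (0 : ℝ) < 2 ^ (r + 1) := by positivity
  have key : ∀ m < 2 ^ (r + 1), f (node r m) ^ 2 ≤ 6 * 2 ^ (r + 1) * ‖toL2 f‖ ^ 2 ∧
      f (node r (m + 1)) ^ 2 ≤ 6 * 2 ^ (r + 1) * ‖toL2 f‖ ^ 2 := by
    intro m hm
    obtain ⟨p, q, h⟩ := hf m hm
    set a : ℝ := m / 2 ^ (r + 1) with ha
    set l : ℝ := 1 / 2 ^ (r + 1) with hl
    have hl0 : 0 < l := by positivity
    have hm' : (m : ℝ) + 1 ≤ 2 ^ (r + 1) := by exact_mod_cast hm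
    have ha0 : 0 ≤ a := by positivity
    have hal : a + l ≤ 1 := by
      rw [ha, hl, ← add_div, div_le_one hp]; exact hm'
    have e1 : 2 ^ (r + 1) * a = m := by rw [ha]; field_simp
    have e2 : 2 ^ (r + 1) * l = 1 := by rw [hl]; field_simp
    have hcont : Continuous fun x : ℝ => f (x : UnitAddCircle) ^ 2 :=
      (f.continuous.comp (AddCircle.continuous_mk' 1)).pow 2
    have hint : ∫ x in a..a + l, f (x : UnitAddCircle) ^ 2 ≤ ‖toL2 f‖ ^ 2 := by
      rw [norm_toL2_sq]
      exact intervalIntegral.integral_mono_interval ha0 (by linarith) hal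
        (ae_of_all _ fun x => sq_nonneg _) (hcont.intervalIntegrable _ _)
    have heq : ∫ x in a..a + l, f (x : UnitAddCircle) ^ 2 =
        ∫ x in a..a + l, ((p * a + q) + p * (x - a)) ^ 2 := by
      refine intervalIntegral.integral_congr fun x hx => ?_
      rw [Set.uIcc_of_le (by linarith)] at hx
      have h1 := mul_le_mul_of_nonneg_left hx.1 hp.le
      have h2 := mul_le_mul_of_nonneg_left hx.2 hp.le
      have h3 : f (x : UnitAddCircle) = (p * a + q) + p * (x - a) := by
        rw [h x (by linarith) (by linarith)]
        ring
      rw [h3]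
    rw [heq, integral_affine_sq] at hint
    have hu : f (node r m) = p * a + q := h a (by linarith) (by linarith)
    have hv : f (node r (m + 1)) = p * a + q + p * l := by
      have e3 : (((m + 1 : ℕ) : ℝ) / 2 ^ (r + 1)) = a + l := by
        rw [ha, hl]; push_cast; ring
      rw [node, e3, h (a + l) (by linarith) (by linarith)]
      ring
    rw [hu, hv]
    set u := p * a + q
    set v := u + p * l
    have h6 : l * (2 * (u ^ 2 + u * v + v ^ 2)) ≤ 6 * ‖toL2 f‖ ^ 2 := by linarith
    have h7 := mul_le_mul_of_nonneg_left h6 hp.le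
    rw [← mul_assoc, e2, one_mul] at h7
    constructor
    · nlinarith [sq_nonneg (u + v), sq_nonneg v]
    · nlinarith [sq_nonneg (u + v), sq_nonneg u]
  rcases hm.lt_or_eq with h | h
  · exact (key m h).1
  · obtain ⟨m', rfl⟩ : ∃ m', m = m' + 1 :=
      ⟨m - 1, by have := Nat.one_le_two_pow (n := r + 1); omega⟩
    exact (key m' (by omega)).2

theorem abs_node_le {r : ℕ} {f : C(UnitAddCircle, ℝ)} (hf : f ∈ dyadicAffine r) {m : ℕ}
    (hm : m ≤ 2 ^ (r + 1)) : |f (node r m)| ≤ 3 * 2 ^ (r + 1) * ‖toL2 f‖ := by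
  refine abs_le_of_sq_le_sq ?_ (by positivity)
  refine (sq_node_le hf hm).trans ?_
  have h1 : (1 : ℝ) ≤ 2 ^ (r + 1) := one_le_pow₀ (by norm_num)
  have h2 : 6 * (2 : ℝ) ^ (r + 1) ≤ (3 * 2 ^ (r + 1)) ^ 2 := by nlinarith
  rw [mul_pow]
  exact mul_le_mul_of_nonneg_right h2 (sq_nonneg _)

/-- Covering by cells of node values: the functions of the ball that agree, up to the integer part
of their node values divided by `a ε / 2`, lie in a common uniform ball of radius `a ε`. -/
theorem coveringNumber_levelSpan_le (r : ℕ) (b₀ : L2T) {a ε : ℝ} (ha : 0 < a) (hε : 0 < ε) :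
    coveringNumber (fun f g : L2T => supNorm (f - g)) (a * ε)
        {b ∈ (levelSpan r : Set L2T) | ‖b - b₀‖ ≤ ε} ≤
      (((2 * ⌈12 * 2 ^ (r + 1) / a⌉₊ + 1) ^ (2 ^ (r + 1) + 1) : ℕ) : ℕ∞) := by
  classical
  set A := {b ∈ (levelSpan r : Set L2T) | ‖b - b₀‖ ≤ ε} with hA
  set N := ⌈12 * 2 ^ (r + 1) / a⌉₊ with hN
  rcases A.eq_empty_or_nonempty with h | ⟨b₁, hb₁⟩
  · exact sInf_le_of_le ⟨∅, rfl, by simp [h]⟩ (by simp)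
  have hex : ∀ b : L2T, ∃ f : C(UnitAddCircle, ℝ), b ∈ A → f ∈ dyadicAffine r ∧ toL2 f = b := by
    intro b
    by_cases hb : b ∈ A
    · obtain ⟨f, h1, h2⟩ := exists_mem_dyadicAffine hb.1
      exact ⟨f, fun _ => ⟨h1, h2⟩⟩
    · exact ⟨0, fun h => absurd h hb⟩
  -- `F b` is the continuous, dyadically affine version of `b`
  choose F hF using hex
  set δ : ℝ := a * ε / 2 with hδ
  have hδ0 : 0 < δ := by positivity
  -- rounded node values, relative to a fixed element of the ball
  let code : L2T → Fin (2 ^ (r + 1) + 1) → ℤ := fun b m => ⌊(F b - F b₁) (node r m) / δ⌋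
  let codes : Finset (Fin (2 ^ (r + 1) + 1) → ℤ) :=
    Fintype.piFinset fun _ => Finset.Icc (-(N : ℤ)) N
  have hcode : ∀ b ∈ A, code b ∈ codes := by
    intro b hb
    refine Fintype.mem_piFinset.2 fun m => ?_
    have hm : (m : ℕ) ≤ 2 ^ (r + 1) := Nat.lt_succ_iff.1 m.2
    have h1 := abs_node_le ((dyadicAffine r).sub_mem (hF b hb).1 (hF b₁ hb₁).1) hm
    have h2 : ‖toL2 (F b - F b₁)‖ ≤ 2 * ε := by
      rw [map_sub, (hF b hb).2, (hF b₁ hb₁).2, ← sub_sub_sub_cancel_right b b₁ b₀]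
      refine (norm_sub_le _ _).trans ?_
      linarith [hb.2, hb₁.2]
    have h3 : |(F b - F b₁) (node r m) / δ| ≤ N := by
      rw [abs_div, abs_of_pos hδ0, div_le_iff₀ hδ0]
      have h4 : 12 * 2 ^ (r + 1) / a ≤ (N : ℝ) := Nat.le_ceil _
      calc _ ≤ 3 * 2 ^ (r + 1) * (2 * ε) :=
            h1.trans (mul_le_mul_of_nonneg_left h2 (by positivity))
        _ = 12 * 2 ^ (r + 1) / a * δ := by rw [hδ]; field_simp; ring
        _ ≤ N * δ := mul_le_mul_of_nonneg_right h4 hδ0.le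
    rw [abs_le] at h3
    refine Finset.mem_Icc.2 ⟨Int.le_floor.2 (by push_cast; exact h3.1), ?_⟩
    exact_mod_cast (Int.floor_le _).trans h3.2
  -- a representative in `A` of each nonempty cell
  let rep : (Fin (2 ^ (r + 1) + 1) → ℤ) → L2T := fun c =>
    if h : ∃ b ∈ A, code b = c then h.choose else 0
  have hrep : ∀ b ∈ A, rep (code b) ∈ A ∧ code (rep (code b)) = code b := by
    intro b hb
    have h : ∃ b' ∈ A, code b' = code b := ⟨b, hb, rfl⟩
    simp only [rep, dif_pos h]
    exact h.choose_spec
  have hcover : coveringNumber (fun f g : L2T => supNorm (f - g)) (a * ε) A ≤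
      ((codes.image rep).card : ℕ∞) := by
    refine sInf_le ⟨codes.image rep, rfl, fun b hb => ⟨rep (code b),
      Finset.mem_image_of_mem _ (hcode b hb), ?_⟩⟩
    obtain ⟨hr, hrc⟩ := hrep b hb
    set b' := rep (code b)
    have hmem := (dyadicAffine r).sub_mem (hF b hb).1 (hF b' hr).1
    have hb' : b - b' = toL2 (F b - F b') := by rw [map_sub, (hF b hb).2, (hF b' hr).2]
    refine (le_of_eq (congrArg supNorm hb')).trans_lt ((supNorm_toL2_le _).trans_lt ?_)
    rw [ENNReal.ofReal_lt_ofReal_iff (by positivity)]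
    refine lt_of_le_of_lt (b := δ) (norm_le_of_nodes hmem fun m hm => ?_)
      (by rw [hδ]; linarith [mul_pos ha hε])
    have h1 : code b' ⟨m, Nat.lt_succ_iff.2 hm⟩ = code b ⟨m, Nat.lt_succ_iff.2 hm⟩ :=
      congrFun hrc _
    have h2 := Int.abs_sub_lt_one_of_floor_eq_floor h1
    rw [← sub_div, abs_div, abs_of_pos hδ0, div_lt_one hδ0, abs_sub_comm] at h2
    simpa using h2.le
  refine hcover.trans ?_
  have hcard : codes.card = (2 * N + 1) ^ (2 ^ (r + 1) + 1) := by
    rw [Fintype.card_piFinset_const, Int.card_Icc]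
    congr 1
    omega
  rw [← hcard]
  exact_mod_cast Finset.card_image_le

/-! ### Lower bounds on the covariance matrices -/

theorem card_levelIndex_succ (r : ℕ) : (levelIndex (r + 1)).card = 2 ^ (r + 1) := by
  have h1 := card_indexSet (r + 1)
  have h0 := card_indexSet r
  rw [Finset.card_eq_sum_ones, sum_indexSet] at h0 h1
  rw [Finset.sum_range_succ, h0, ← Finset.card_eq_sum_ones] at h1
  have : 2 ^ (r + 1 + 1) = 2 * 2 ^ (r + 1) := by ring
  omega

theorem sum_sq_two_rpow_neg_level_le (r : ℕ) :
    ∑ i ∈ indexSet r, ((2 : ℝ) ^ (-(level i : ℝ))) ^ 2 ≤ 3 - (2 ^ r)⁻¹ := by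
  have hpow : ∀ i : ℕ+, ((2 : ℝ) ^ (-(level i : ℝ))) ^ 2 = ((2 ^ level i)⁻¹) ^ 2 := fun i => by
    rw [Real.rpow_neg (by norm_num), Real.rpow_natCast]
  simp only [hpow]
  induction r with
  | zero =>
    have : ∑ i ∈ indexSet 0, (((2 : ℝ) ^ level i)⁻¹) ^ 2 = ∑ i ∈ indexSet 0, 1 :=
      Finset.sum_congr rfl fun i hi => by
        rw [Nat.le_zero.1 (mem_indexSet_iff.1 hi)]; norm_num
    rw [this, Finset.sum_const, card_indexSet]
    norm_num
  | succ r ih =>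
    have : ∑ i ∈ levelIndex (r + 1), (((2 : ℝ) ^ level i)⁻¹) ^ 2 = (2 ^ (r + 1))⁻¹ := by
      rw [Finset.sum_congr rfl fun i hi => by rw [mem_levelIndex.1 hi], Finset.sum_const,
        card_levelIndex_succ, nsmul_eq_mul]
      push_cast
      field_simp
    rw [sum_indexSet] at ih ⊢
    rw [Finset.sum_range_succ, this]
    have : ((2 : ℝ) ^ r)⁻¹ = 2 * (2 ^ (r + 1))⁻¹ := by rw [pow_succ]; field_simp
    linarith

/-- Under condition (B) the quadratic form of the covariance matrix is bounded below by its
diagonal part: the off-diagonal part, rescaled by the standard deviations, has Hilbert-Schmidt norm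
at most `3 c₃`. -/
theorem CovB.posSemidef_sub {A : ℕ+ → ℕ+ → ℝ} (hA : ∀ i j, A i j = A j i) {c₁ c₃ : ℝ}
    (h3 : 0 < c₃) (hdiag : ∀ i, c₁ * (2 : ℝ) ^ (-(level i : ℝ)) ≤ A i i)
    (hoff : ∀ i i', i ≠ i' →
      |A i i'| ≤ c₃ * (2 : ℝ) ^ (-(1.5 : ℝ) * ((level i : ℝ) + level i'))) (r : ℕ) :
    (Matrix.of (fun i j : indexSet r => A i j) -
      Matrix.diagonal fun i : indexSet r =>
        (c₁ - 3 * c₃) * (2 : ℝ) ^ (-(level i : ℝ))).PosSemidef := by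
  classical
  refine Matrix.PosSemidef.of_dotProduct_mulVec_nonneg ?_ fun x => ?_
  · ext i j
    by_cases hij : i = j
    · subst hij; simp
    · simp [Matrix.diagonal_apply_ne _ hij, Matrix.diagonal_apply_ne' _ hij, hA j i]
  · set u : indexSet r → ℝ := fun i => (2 : ℝ) ^ (-(level (i : ℕ+) : ℝ)) with hu
    set w : indexSet r → ℝ := fun i => (2 : ℝ) ^ (-(1.5 : ℝ) * level (i : ℕ+)) * |x i| with hw
    have hw0 : ∀ i, 0 ≤ w i := fun i => by positivity
    have hform : star x ⬝ᵥ (Matrix.of (fun i j : indexSet r => A i j) -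
        Matrix.diagonal fun i : indexSet r => (c₁ - 3 * c₃) * (2 : ℝ) ^ (-(level i : ℝ))).mulVec x
        = ∑ i, ∑ j, x i * x j * A i j - ∑ i, (c₁ - 3 * c₃) * (u i * x i ^ 2) := by
      rw [Matrix.sub_mulVec, dotProduct_sub]
      congr 1
      · simp only [dotProduct, Matrix.mulVec, Matrix.of_apply, Finset.mul_sum, star_trivial]
        exact Finset.sum_congr rfl fun i _ => Finset.sum_congr rfl fun j _ => by ring
      · simp only [dotProduct, Matrix.mulVec_diagonal, star_trivial]
        exact Finset.sum_congr rfl fun i _ => by ring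
    have hterm : ∀ i j : indexSet r, (if i = j then c₁ * (u i * x i ^ 2) else 0) -
        c₃ * (w i * w j) ≤ x i * x j * A i j := by
      intro i j
      have hww := mul_nonneg h3.le (mul_nonneg (hw0 i) (hw0 j))
      split_ifs with hij
      · subst hij
        have := mul_le_mul_of_nonneg_right (hdiag i) (sq_nonneg (x i))
        simp only [hu]
        linarith
      · have hne : (i : ℕ+) ≠ j := fun h => hij (Subtype.ext h)
        have h1 := mul_le_mul_of_nonneg_left (hoff i j hne) (abs_nonneg (x i * x j))
        have h2 : |x i * x j| * (c₃ * (2 : ℝ) ^ (-(1.5 : ℝ) * ((level (i : ℕ+) : ℝ) +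
            level (j : ℕ+)))) = c₃ * (w i * w j) := by
          rw [mul_add, Real.rpow_add (by norm_num), abs_mul]
          simp only [hw]
          ring
        rw [h2, ← abs_mul] at h1
        linarith [neg_abs_le (x i * x j * A i j)]
    have hsum := Finset.sum_le_sum fun i (_ : i ∈ Finset.univ) =>
      Finset.sum_le_sum fun j (_ : j ∈ Finset.univ) => hterm i j
    simp only [Finset.sum_sub_distrib, Finset.sum_ite_eq, Finset.mem_univ, if_true,
      ← Finset.mul_sum] at hsum
    rw [← Finset.sum_mul] at hsum
    -- Cauchy-Schwarz after splitting `2^{-1.5 ℓ} = 2^{-ℓ} 2^{-0.5 ℓ}`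
    have hCS : (∑ i, w i) * ∑ j, w j ≤ 3 * ∑ i, u i * x i ^ 2 := by
      have h1 : ∀ i, w i = u i * ((2 : ℝ) ^ (-(0.5 : ℝ) * level (i : ℕ+)) * |x i|) := fun i => by
        simp only [hw, hu]
        rw [← mul_assoc, ← Real.rpow_add (by norm_num)]
        congr 2
        ring
      have h2 : ∀ i : indexSet r, ((2 : ℝ) ^ (-(0.5 : ℝ) * level (i : ℕ+)) * |x i|) ^ 2 =
          u i * x i ^ 2 :=
        fun i => by
          rw [mul_pow, sq_abs, ← Real.rpow_mul_natCast (by norm_num)]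
          simp only [hu]
          congr 2
          push_cast
          ring
      have h3 := Finset.sum_mul_sq_le_sq_mul_sq Finset.univ u
        fun i => (2 : ℝ) ^ (-(0.5 : ℝ) * level (i : ℕ+)) * |x i|
      simp only [← h1, h2] at h3
      have h4 : ∑ i, u i ^ 2 ≤ 3 := by
        have := sum_sq_two_rpow_neg_level_le r
        rw [← Finset.sum_coe_sort] at this
        exact this.trans (by linarith [inv_nonneg.2 (pow_nonneg (zero_le_two (α := ℝ)) r)])
      have h5 : 0 ≤ ∑ i, u i * x i ^ 2 := Finset.sum_nonneg fun i _ => by positivity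
      rw [← sq]
      exact h3.trans (mul_le_mul_of_nonneg_right h4 h5)
    rw [hform, ← Finset.mul_sum]
    have := mul_le_mul_of_nonneg_left hCS h3.le
    linarith

/-- Both covariance conditions imply that the covariance matrix dominates, and on the diagonal is
comparable with, a multiple of the diagonal matrix with entries `2^{-2αℓ(i)}`. -/
theorem exists_posSemidef_sub {A : ℕ+ → ℕ+ → ℝ} (hA : ∀ i j, A i j = A j i) {α : ℝ}
    (hcov : (0 < α ∧ CovA α A) ∨ (α = 1 / 2 ∧ CovB A)) :
    ∃ lam c : ℝ, 0 < lam ∧ 0 < c ∧ (∀ i, A i i ≤ c * (lam * (2 : ℝ) ^ (-2 * α * level i))) ∧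
      ∀ r, (Matrix.of (fun i j : indexSet r => A i j) - Matrix.diagonal fun i : indexSet r =>
        lam * (2 : ℝ) ^ (-2 * α * level i)).PosSemidef := by
  classical
  rcases hcov with ⟨-, hd, ho⟩ | ⟨rfl, c₁, c₂, c₃, h1, h12, h3, h31, hd, ho⟩
  · refine ⟨1, 1, one_pos, one_pos, fun i => by rw [hd, one_mul, one_mul], fun r => ?_⟩
    convert Matrix.PosSemidef.zero using 1
    ext i j
    by_cases hij : i = j
    · subst hij; simp [hd]
    · simp [Matrix.diagonal_apply_ne _ hij, ho i j fun h => hij (Subtype.ext h)]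
  · have hexp : ∀ i : ℕ+, (2 : ℝ) ^ (-2 * (1 / 2 : ℝ) * level i) = (2 : ℝ) ^ (-(level i : ℝ)) :=
      fun i => by congr 1; ring
    have hpos : 0 < c₁ - 3 * c₃ := by linarith
    simp only [hexp]
    refine ⟨c₁ - 3 * c₃, c₂ / (c₁ - 3 * c₃), hpos, div_pos (h1.trans h12) hpos, fun i => ?_,
      fun r => CovB.posSemidef_sub hA h3 (fun i => (hd i).1) ho r⟩
    rw [← mul_assoc, div_mul_cancel₀ _ hpos.ne']
    exact (hd i).2

/-! ### The small ball probability of the prior -/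

/-- If `c` bounds the conditional probability of `U` from below whenever the independent variable
`Y` lies in `T`, then the joint event has probability at least `c` times that of `Y ∈ T`. -/
theorem mul_le_measure_of_indepFun {Ω 𝓧 𝓨 : Type*} [MeasurableSpace Ω] [MeasurableSpace 𝓧]
    [MeasurableSpace 𝓨] {P : Measure Ω} [IsProbabilityMeasure P] {X : Ω → 𝓧} {Y : Ω → 𝓨}
    (hX : Measurable X) (hY : Measurable Y) (hind : IndepFun X Y P) {T : Set 𝓨}
    (hT : MeasurableSet T) {U : Set (𝓧 × 𝓨)} (hU : MeasurableSet U) {c : ℝ≥0∞}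
    (h : ∀ y ∈ T, c ≤ P {ω | (X ω, y) ∈ U}) :
    c * P (Y ⁻¹' T) ≤ P {ω | Y ω ∈ T ∧ (X ω, Y ω) ∈ U} := by
  have hpX : IsProbabilityMeasure (P.map X) := Measure.isProbabilityMeasure_map hX.aemeasurable
  have hpY : IsProbabilityMeasure (P.map Y) := Measure.isProbabilityMeasure_map hY.aemeasurable
  have hm : MeasurableSet (Prod.snd ⁻¹' T ∩ U : Set (𝓧 × 𝓨)) := (measurable_snd hT).inter hU
  have e : P {ω | Y ω ∈ T ∧ (X ω, Y ω) ∈ U} =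
      P.map (fun ω => (X ω, Y ω)) (Prod.snd ⁻¹' T ∩ U) := by
    rw [Measure.map_apply (hX.prodMk hY) hm]
    rfl
  rw [e, (indepFun_iff_map_prod_eq_prod_map_map hX.aemeasurable hY.aemeasurable).1 hind,
    Measure.prod_apply_symm hm, ← Measure.map_apply hY hT, ← setLIntegral_const]
  refine (setLIntegral_mono' hT fun y hy => ?_).trans (setLIntegral_le_lintegral T _)
  rw [Measure.map_apply hX (measurable_prodMk_right hm)]
  refine (h y hy).trans (measure_mono fun ω hω => ⟨hy, hω⟩)

theorem supNorm_prior_sub_le {Ω : Type*} {Z : ℕ+ → Ω → ℝ} {R : Ω → ℕ} {S : Ω → ℝ} {ω : Ω}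
    {z : ℕ+ → ℝ} {f : C(UnitAddCircle, ℝ)} {η D : ℝ}
    (hZ : ∀ i ∈ indexSet (R ω), |S ω * Z i ω - z i| ≤ η)
    (hf : ‖f - ∑ i ∈ indexSet (R ω), z i • psiCircle i‖ ≤ D) :
    supNorm (prior Z R S ω - toL2 f) ≤ ENNReal.ofReal (2 * (R ω + 1) * η + D) := by
  have e : prior Z R S ω - toL2 f =
      toL2 (∑ i ∈ indexSet (R ω), (S ω * Z i ω - z i) • psiCircle i -
        (f - ∑ i ∈ indexSet (R ω), z i • psiCircle i)) := by
    rw [prior, sub_sub_eq_add_sub, ← Finset.sum_add_distrib, map_sub, map_sum, Finset.smul_sum]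
    congr 1
    refine Finset.sum_congr rfl fun i _ => ?_
    rw [← add_smul, sub_add_cancel, map_smul, toL2_psiCircle, smul_smul]
  rw [e]
  refine (supNorm_toL2_le _).trans (ENNReal.ofReal_le_ofReal ?_)
  exact (norm_sub_le _ _).trans (add_le_add (norm_sum_indexSet_le _ _ hZ) hf)

section SmallBall

variable {Ω : Type*} [MeasurableSpace Ω] {P : Measure Ω} [IsProbabilityMeasure P]

/-- The Gaussian coefficients, scaled by `s`, approximate the coefficients of a smooth function with
probability at least `exp(-K 2^r r)`: each of the `2^{r+1}` coordinates contributes at most a factor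
exponential in `r`, as long as `s` lies between `2^{|α-β| r}` and a fixed power of `2^r`. -/
theorem exists_exp_le_measure_coefficients {Z : ℕ+ → Ω → ℝ} (hGauss : IsGaussianProcess Z P)
    (hmean : ∀ i, ∫ ω, Z i ω ∂P = 0) {α β : ℝ} (hβ : 0 < β)
    (hcov : (0 < α ∧ CovA α (fun i i' => cov[Z i, Z i'; P])) ∨
      (α = 1 / 2 ∧ CovB (fun i i' => cov[Z i, Z i'; P])))
    {z : ℕ+ → ℝ} {M : ℝ} (hM : ∀ i, |z i| ≤ M * (2 : ℝ) ^ (-β * level i)) {κ : ℝ} (hκ : 0 ≤ κ) :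
    ∃ K : ℝ, 0 < K ∧ ∀ r : ℕ, 1 ≤ r → ∀ s : ℝ, (2 : ℝ) ^ (|α - β| * r) ≤ s →
      s ≤ (2 : ℝ) ^ (κ * r) → ENNReal.ofReal (Real.exp (-(K * (2 ^ r * r)))) ≤
        P {ω | ∀ i ∈ indexSet r, |s * Z i ω - z i| ≤ (2 : ℝ) ^ (-β * r) / (2 * (r + 1))} := by
  have hα : 0 < α := by
    rcases hcov with h | h
    · exact h.1
    · rw [h.1]; norm_num
  obtain ⟨lam, c, hlam, hc, hdiag, hpsd⟩ :=
    exists_posSemidef_sub (fun i j => covariance_comm (Z i) (Z j)) hcov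
  set k₁ : ℝ := (β + 1 + κ) * Real.log 2 + |Real.log √(2 * Real.pi * lam)| with hk₁
  set k₂ : ℝ := k₁ + (2 * M ^ 2 + 1) / lam with hk₂
  have hlog2 : 0 < Real.log 2 := Real.log_pos (by norm_num)
  have hk₁0 : 0 < k₁ := add_pos_of_pos_of_nonneg (by positivity) (abs_nonneg _)
  have hk₂0 : 0 < k₂ := add_pos_of_pos_of_nonneg hk₁0 (by positivity)
  refine ⟨2 * (k₂ + 2 * c), by positivity, fun r hr s hs1 hs2 => ?_⟩
  have hr' : (1 : ℝ) ≤ r := by exact_mod_cast hr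
  have hs0 : 0 < s := lt_of_lt_of_le (by positivity) hs1
  set η : ℝ := (2 : ℝ) ^ (-β * r) / (2 * (r + 1)) with hη
  have hη0 : 0 < η := by positivity
  have hM0 : 0 ≤ M := by
    by_contra h
    have h1 := hM 1
    have : M * (2 : ℝ) ^ (-β * level 1) < 0 := mul_neg_of_neg_of_pos (not_le.1 h) (by positivity)
    linarith [abs_nonneg (z 1)]
  let v : indexSet r → NNReal := fun i =>
    ⟨lam * (2 : ℝ) ^ (-2 * α * level (i : ℕ+)), by positivity⟩
  have hvc : ∀ i : indexSet r, (v i : ℝ) = lam * (2 : ℝ) ^ (-2 * α * level (i : ℕ+)) :=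
    fun i => rfl
  have hvpos : ∀ i, (0 : ℝ) < v i := fun i => by rw [hvc]; positivity
  have hlaw : HasGaussianLaw (fun ω (i : indexSet r) => Z i ω) P := hGauss.hasGaussianLaw _
  have hbox := ofReal_prod_le_measure_box hlaw (fun i => hmean i) (v := v)
    (fun i => NNReal.coe_ne_zero.1 (hvpos i).ne') (hpsd r) (c := c) (fun i => hdiag i)
    (fun i => z i / s) (δ := η / s) (by positivity)
  refine (le_trans ?_ hbox).trans (measure_mono fun ω hω i hi => ?_)
  · refine ENNReal.ofReal_le_ofReal ?_
    have hfac : ∀ i : indexSet r, Real.exp (-(k₂ * r)) ≤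
        2 * (η / s) / √(2 * Real.pi * v i) *
          Real.exp (-(2 * (z i / s) ^ 2 + (η / s) ^ 2) / v i) := by
      intro i
      have hl : (level (i : ℕ+) : ℝ) ≤ r := by exact_mod_cast mem_indexSet_iff.1 i.2
      have hl0 : (0 : ℝ) ≤ level (i : ℕ+) := Nat.cast_nonneg _
      -- the square root of `v i / lam`
      set σ : ℝ := (2 : ℝ) ^ (-α * level (i : ℕ+)) with hσ
      have hσ0 : 0 < σ := by positivity
      have hvσ : (v i : ℝ) = lam * σ ^ 2 := by
        rw [hvc, hσ, ← Real.rpow_mul_natCast (by norm_num)]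
        congr 2
        push_cast
        ring
      have hσ1 : σ ≤ 1 := Real.rpow_le_one_of_one_le_of_nonpos (by norm_num) (by nlinarith)
      have hzs : |z i / s| ≤ M * σ := by
        rw [abs_div, abs_of_pos hs0, div_le_iff₀ hs0]
        refine (hM i).trans ?_
        rw [mul_assoc]
        refine mul_le_mul_of_nonneg_left ?_ hM0
        refine le_trans ?_ (mul_le_mul_of_nonneg_left hs1 hσ0.le)
        rw [hσ, ← Real.rpow_add (by norm_num)]
        refine Real.rpow_le_rpow_of_exponent_le (by norm_num) ?_
        have h1 : (α - β) * level (i : ℕ+) ≤ |α - β| * r :=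
          mul_le_mul (le_abs_self _) hl hl0 (abs_nonneg _)
        linarith
      have hηs : η / s ≤ σ := by
        rw [div_le_iff₀ hs0]
        have h1 : η ≤ (2 : ℝ) ^ (-β * r) := by
          rw [hη]
          exact div_le_self (by positivity) (by linarith)
        refine h1.trans (le_trans ?_ (mul_le_mul_of_nonneg_left hs1 hσ0.le))
        rw [hσ, ← Real.rpow_add (by norm_num)]
        refine Real.rpow_le_rpow_of_exponent_le (by norm_num) ?_
        have h2 : (α - β) * r ≤ |α - β| * r :=
          mul_le_mul_of_nonneg_right (le_abs_self _) (by linarith)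
        have h3 : α * level (i : ℕ+) ≤ α * r := mul_le_mul_of_nonneg_left hl hα.le
        linarith
      have hexp : (2 * (z i / s) ^ 2 + (η / s) ^ 2) / v i ≤ (2 * M ^ 2 + 1) / lam := by
        rw [div_le_div_iff₀ (hvpos i) hlam, hvσ]
        have h1 : (z i / s) ^ 2 ≤ (M * σ) ^ 2 := sq_le_sq' (abs_le.1 hzs).1 (abs_le.1 hzs).2
        have h2 : (η / s) ^ 2 ≤ σ ^ 2 := pow_le_pow_left₀ (by positivity) hηs 2
        have h3 : 2 * (z i / s) ^ 2 + (η / s) ^ 2 ≤ (2 * M ^ 2 + 1) * σ ^ 2 := by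
          rw [mul_pow] at h1; linarith
        calc _ ≤ (2 * M ^ 2 + 1) * σ ^ 2 * lam := mul_le_mul_of_nonneg_right h3 hlam.le
          _ = _ := by ring
      have hden : Real.exp (-(k₁ * r)) ≤ 2 * (η / s) / √(2 * Real.pi * v i) := by
        have hq0 : 0 < √(2 * Real.pi * lam) := by positivity
        have h1 : √(2 * Real.pi * v i) ≤ √(2 * Real.pi * lam) := by
          refine Real.sqrt_le_sqrt (mul_le_mul_of_nonneg_left ?_ (by positivity))
          rw [hvσ]
          exact mul_le_of_le_one_right hlam.le (pow_le_one₀ hσ0.le hσ1)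
        have h2 : (2 : ℝ) ^ (-(β + 1 + κ) * r) ≤ 2 * (η / s) := by
          have h3 : (r : ℝ) + 1 ≤ (2 : ℝ) ^ (r : ℝ) := by
            rw [Real.rpow_natCast]
            exact_mod_cast Nat.lt_two_pow_self (n := r)
          have h4 : 2 * (η / s) = (2 : ℝ) ^ (-β * r) / ((r + 1) * s) := by
            rw [hη]; field_simp
          rw [h4, le_div_iff₀ (by positivity)]
          calc (2 : ℝ) ^ (-(β + 1 + κ) * r) * ((r + 1) * s)
              ≤ (2 : ℝ) ^ (-(β + 1 + κ) * r) * ((2 : ℝ) ^ (r : ℝ) * (2 : ℝ) ^ (κ * r)) := by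
                refine mul_le_mul_of_nonneg_left ?_ (by positivity)
                exact mul_le_mul h3 hs2 hs0.le (by positivity)
            _ = (2 : ℝ) ^ (-β * r) := by
                rw [← Real.rpow_add (by norm_num), ← Real.rpow_add (by norm_num)]
                congr 1
                ring
        have h5 : Real.exp (-(k₁ * r)) ≤ (2 : ℝ) ^ (-(β + 1 + κ) * r) / √(2 * Real.pi * lam) := by
          rw [Real.rpow_def_of_pos (by norm_num)]
          nth_rewrite 1 [← Real.exp_log hq0]
          rw [← Real.exp_sub]
          refine Real.exp_le_exp.2 ?_
          have h6 : Real.log √(2 * Real.pi * lam) ≤ |Real.log √(2 * Real.pi * lam)| * r :=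
            (le_abs_self _).trans (le_mul_of_one_le_right (abs_nonneg _) hr')
          rw [hk₁]
          linarith
        refine h5.trans ?_
        exact div_le_div₀ (by positivity) h2 (Real.sqrt_pos.2 (by have := hvpos i; positivity)) h1
      have e : Real.exp (-(k₂ * r)) ≤ Real.exp (-(k₁ * r)) *
          Real.exp (-((2 * M ^ 2 + 1) / lam)) := by
        rw [← Real.exp_add]
        refine Real.exp_le_exp.2 ?_
        have : (2 * M ^ 2 + 1) / lam ≤ (2 * M ^ 2 + 1) / lam * r :=
          le_mul_of_one_le_right (by positivity) hr'
        rw [hk₂]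
        linarith
      refine e.trans (mul_le_mul hden (Real.exp_le_exp.2 ?_) (Real.exp_pos _).le (by positivity))
      rw [neg_div]
      exact neg_le_neg hexp
    have hprod := Finset.prod_le_prod (s := Finset.univ) (fun i _ => (Real.exp_pos _).le)
      fun i _ => hfac i
    have hcard : Fintype.card (indexSet r) = 2 ^ (r + 1) := by
      rw [Fintype.card_coe, card_indexSet]
    rw [Finset.prod_const, Finset.card_univ, hcard, ← Real.exp_nat_mul] at hprod
    refine le_trans ?_ (mul_le_mul_of_nonneg_right hprod (Real.exp_pos _).le)
    rw [← Real.exp_add, hcard]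
    refine Real.exp_le_exp.2 ?_
    push_cast
    rw [pow_succ]
    have : (2 : ℝ) ^ r * c ≤ 2 ^ r * c * r := le_mul_of_one_le_right (by positivity) hr'
    nlinarith
  · have h := hω ⟨i, hi⟩
    simp only at h
    have e : s * Z i ω - z i = s * (Z i ω - z i / s) := by field_simp
    rw [e, abs_mul, abs_of_pos hs0]
    calc s * |Z i ω - z i / s| ≤ s * (η / s) := mul_le_mul_of_nonneg_left h hs0.le
      _ = η := by field_simp

/-- The prior puts mass at least `exp(-K 2^r r)` on the uniform ball of radius of order `2^{-β r}`
around a `β`-smooth function: take truncation level `r` and scaling factor between `x ^ p₁` and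
`x ^ p₂`, where `x = 2^{r/q}`. -/
theorem exists_exp_le_measure_ball {Z : ℕ+ → Ω → ℝ} {R : Ω → ℕ} {S : Ω → ℝ}
    (hZ : ∀ i, Measurable (Z i)) (hR : Measurable R) (hS : Measurable S)
    (hGauss : IsGaussianProcess Z P) (hmean : ∀ i, ∫ ω, Z i ω ∂P = 0)
    (hindZ : IndepFun (fun ω i => Z i ω) (fun ω => (R ω, S ω)) P)
    (hindRS : IndepFun R S P) {b₀ : L2T} {α β : ℝ} (hβ : 0 < β) (hb₀ : IsSmooth β b₀)
    (hcov : (0 < α ∧ CovA α (fun i i' => cov[Z i, Z i'; P])) ∨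
      (α = 1 / 2 ∧ CovB (fun i i' => cov[Z i, Z i'; P])))
    (htrunc : TruncationCond P R) (hscale : ScalingCond P S α β) :
    ∃ K D : ℝ, 0 < K ∧ 0 < D ∧ ∀ᶠ r : ℕ in atTop,
      ENNReal.ofReal (Real.exp (-(K * (2 ^ r * r)))) ≤
        P {ω | supNorm (prior Z R S ω - b₀) ≤ ENNReal.ofReal (D * (2 : ℝ) ^ (-β * r))} := by
  obtain ⟨z, hz, M, hM⟩ := hb₀
  have hM' : ∀ i, |z i| ≤ M * (2 : ℝ) ^ (-β * level i) := fun i => by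
    have h := hM ⟨i, rfl⟩
    rw [neg_mul, Real.rpow_neg (by norm_num), ← div_eq_mul_inv, le_div_iff₀ (by positivity)]
    simp only at h
    linarith
  obtain ⟨f, rfl, D, hD⟩ := exists_continuous_version hβ hz hM'
  obtain ⟨d₁, d₂, -, hd₂, htr⟩ := htrunc
  obtain ⟨p₁, p₂, q, C, hp₁, hp₁₂, hq, hC, hqp, hsc⟩ := hscale
  obtain ⟨K, hK, hcoef⟩ := exists_exp_le_measure_coefficients hGauss hmean hβ hcov hM'
    (κ := p₂ / q) (by have := hp₁.trans hp₁₂; positivity)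
  refine ⟨K + d₂ + 1, |D| + 1, by positivity, by positivity, ?_⟩
  have hx : Tendsto (fun r : ℕ => (2 : ℝ) ^ ((r : ℝ) / q)) atTop atTop :=
    (tendsto_rpow_atTop_of_base_gt_one 2 (by norm_num)).comp
      (tendsto_natCast_atTop_atTop.atTop_div_const hq)
  filter_upwards [hx.eventually_ge_atTop C, eventually_ge_atTop 1] with r hrC hr
  have hr' : (1 : ℝ) ≤ r := by exact_mod_cast hr
  set x : ℝ := (2 : ℝ) ^ ((r : ℝ) / q) with hxdef
  set η : ℝ := (2 : ℝ) ^ (-β * r) / (2 * (r + 1)) with hη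
  have hxp : ∀ p : ℝ, x ^ p = (2 : ℝ) ^ (p / q * r) := fun p => by
    rw [hxdef, ← Real.rpow_mul (by norm_num)]
    congr 1
    ring
  let T : Set (ℕ × ℝ) := {r} ×ˢ Set.Icc (x ^ p₁) (x ^ p₂)
  let U : Set ((ℕ+ → ℝ) × (ℕ × ℝ)) := {y | ∀ i ∈ indexSet r, |y.2.2 * y.1 i - z i| ≤ η}
  have hT : MeasurableSet T := (measurableSet_singleton r).prod measurableSet_Icc
  have hU : MeasurableSet U := by
    have : U = ⋂ i ∈ indexSet r, {y | |y.2.2 * y.1 i - z i| ≤ η} := by ext; simp [U]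
    rw [this]
    refine Finset.measurableSet_biInter _ fun i _ => measurableSet_le ?_ measurable_const
    fun_prop
  have hmain := mul_le_measure_of_indepFun (measurable_pi_lambda _ hZ) (hR.prodMk hS) hindZ hT hU
    (c := ENNReal.ofReal (Real.exp (-(K * (2 ^ r * r))))) (by
      rintro ⟨n, s⟩ ⟨-, hs⟩
      refine hcoef r hr s (le_trans ?_ hs.1) (hs.2.trans (hxp p₂).le)
      rw [hxp]
      refine Real.rpow_le_rpow_of_exponent_le (by norm_num)
        (mul_le_mul_of_nonneg_right ?_ (by linarith))
      rw [le_div_iff₀ hq]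
      linarith)
  have hprob : ENNReal.ofReal (Real.exp (-d₂ * 2 ^ r * r) * Real.exp (-x ^ q)) ≤
      P ((fun ω => (R ω, S ω)) ⁻¹' T) := by
    have e : (fun ω => (R ω, S ω)) ⁻¹' T = R ⁻¹' {r} ∩ S ⁻¹' Set.Icc (x ^ p₁) (x ^ p₂) := by
      ext; simp [T]
    rw [e, hindRS.measure_inter_preimage_eq_mul _ _ (measurableSet_singleton r) measurableSet_Icc,
      ENNReal.ofReal_mul (Real.exp_pos _).le]
    exact mul_le_mul' (ENNReal.ofReal_le_of_le_toReal (htr r hr).2)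
      (ENNReal.ofReal_le_of_le_toReal (hsc x hrC))
  refine le_trans ?_ ((mul_le_mul' le_rfl hprob).trans (hmain.trans (measure_mono ?_)))
  · rw [← ENNReal.ofReal_mul (Real.exp_pos _).le, ← Real.exp_add, ← Real.exp_add]
    refine ENNReal.ofReal_le_ofReal (Real.exp_le_exp.2 ?_)
    rw [hxp, div_self hq.ne', one_mul, Real.rpow_natCast]
    have : (2 : ℝ) ^ r ≤ 2 ^ r * r := le_mul_of_one_le_right (by positivity) hr'
    linarith
  · rintro ω ⟨⟨hRω, -⟩, hω⟩
    have hRr : R ω = r := hRω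
    refine (supNorm_prior_sub_le (z := z) (η := η) (D := D * (2 : ℝ) ^ (-β * r))
      (fun i hi => hω i (hRr ▸ hi)) (by rw [hRr]; exact hD r)).trans (ENNReal.ofReal_le_ofReal ?_)
    rw [hRr]
    have h1 : 2 * ((r : ℝ) + 1) * η = (2 : ℝ) ^ (-β * r) := by rw [hη]; field_simp
    have h2 : D * (2 : ℝ) ^ (-β * r) ≤ |D| * (2 : ℝ) ^ (-β * r) :=
      mul_le_mul_of_nonneg_right (le_abs_self D) (by positivity)
    rw [h1]
    linarith

end SmallBall

/-! ### Levels matching a given rate -/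

/-- The level `r` with `2 ^ (r - 1) ≤ L ε^{-1/β} < 2 ^ r` (for small `ε`). -/
noncomputable def rateLevel (β L ε : ℝ) : ℕ := ⌊Real.logb 2 (L * ε ^ (-1 / β))⌋₊ + 1

theorem one_le_rateLevel (β L ε : ℝ) : 1 ≤ rateLevel β L ε := Nat.le_add_left _ _

theorem lt_two_pow_rateLevel (β : ℝ) {L ε : ℝ} (hL : 0 < L) (hε : 0 < ε) :
    L * ε ^ (-1 / β) < 2 ^ rateLevel β L ε := by
  have h : Real.logb 2 (L * ε ^ (-1 / β)) < rateLevel β L ε := by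
    rw [rateLevel]
    push_cast
    exact Nat.lt_floor_add_one _
  rwa [Real.logb_lt_iff_lt_rpow (by norm_num) (by positivity), Real.rpow_natCast] at h

/-- The uniform approximation error at level `rateLevel β (D ^ (1 / β)) ε` is smaller than `ε`. -/
theorem mul_rpow_rateLevel_lt {β D ε : ℝ} (hβ : 0 < β) (hD : 0 < D) (hε : 0 < ε) :
    D * (2 : ℝ) ^ (-β * rateLevel β (D ^ (1 / β)) ε) < ε := by
  have h := lt_two_pow_rateLevel β (L := D ^ (1 / β)) (by positivity) hε
  set r := rateLevel β (D ^ (1 / β)) ε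
  have h1 := Real.rpow_lt_rpow (by positivity) h hβ
  have e1 : (D ^ (1 / β) * ε ^ (-1 / β)) ^ β = D / ε := by
    rw [Real.mul_rpow (by positivity) (by positivity), ← Real.rpow_mul hD.le,
      ← Real.rpow_mul hε.le, div_mul_cancel₀ _ hβ.ne', div_mul_cancel₀ _ hβ.ne', Real.rpow_one,
      Real.rpow_neg_one, div_eq_mul_inv]
  have e2 : (2 : ℝ) ^ (-β * r) = (((2 : ℝ) ^ r) ^ β)⁻¹ := by
    rw [← Real.rpow_natCast, ← Real.rpow_mul (by norm_num), ← Real.rpow_neg (by norm_num)]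
    congr 1
    ring
  rw [e1, div_lt_iff₀ hε] at h1
  rw [e2, ← div_eq_mul_inv, div_lt_iff₀ (by positivity)]
  linarith

theorem tendsto_logb_mul_rpow {β L : ℝ} (hβ : 0 < β) (hL : 0 < L) :
    Tendsto (fun ε : ℝ => Real.logb 2 (L * ε ^ (-1 / β))) (𝓝[>] 0) atTop := by
  refine (Real.tendsto_logb_atTop (by norm_num)).comp (Tendsto.const_mul_atTop hL ?_)
  exact tendsto_rpow_neg_nhdsGT_zero (by rw [neg_div, neg_lt_zero]; positivity)

/-- For small `ε` the quantity `2 ^ r * r` is of the order of the rate at `r = rateLevel β L ε`. -/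
theorem eventually_rateLevel_bounds {β L : ℝ} (hβ : 0 < β) (hL : 0 < L) :
    ∀ᶠ ε in 𝓝[>] (0 : ℝ),
      L / (2 * β * Real.log 2) * rate β ε ≤ 2 ^ rateLevel β L ε * rateLevel β L ε ∧
      2 ^ rateLevel β L ε * rateLevel β L ε ≤ 4 * L / (β * Real.log 2) * rate β ε := by
  have hlog2 : 0 < Real.log 2 := Real.log_pos (by norm_num)
  have hlog : Tendsto (fun ε : ℝ => -Real.log ε) (𝓝[>] 0) atTop :=
    tendsto_neg_atBot_atTop.comp Real.tendsto_log_nhdsGT_zero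
  filter_upwards [self_mem_nhdsWithin, (tendsto_logb_mul_rpow hβ hL).eventually_ge_atTop 0,
    hlog.eventually_ge_atTop (2 * β * (|Real.log L| + Real.log 2))] with ε hε hy hl
  have hε : 0 < ε := hε
  set y := Real.logb 2 (L * ε ^ (-1 / β)) with hydef
  set r := rateLevel β L ε with hr
  set t := -Real.log ε with ht
  have hL' := abs_nonneg (Real.log L)
  have ht0 : 0 ≤ t := le_trans (by positivity) hl
  have habs : |Real.log ε| = t := by rw [ht, ← abs_neg, abs_of_nonneg ht0]
  have hyt : y * Real.log 2 = Real.log L + t / β := by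
    rw [hydef, Real.logb, div_mul_cancel₀ _ hlog2.ne', Real.log_mul hL.ne' (by positivity),
      Real.log_rpow hε, ht]
    ring
  have hr1 : (r : ℝ) ≤ y + 1 := by
    rw [hr, rateLevel]
    push_cast
    linarith [Nat.floor_le hy]
  have hr2 : y < r := by
    rw [hr, rateLevel]
    push_cast
    exact Nat.lt_floor_add_one _
  have hl' : 2 * (|Real.log L| + Real.log 2) ≤ t / β := by
    rw [le_div_iff₀ hβ]; linarith
  have hlow : t / (2 * β * Real.log 2) ≤ r := by
    rw [div_le_iff₀ (by positivity)]
    have h1 : y * Real.log 2 ≤ r * Real.log 2 := mul_le_mul_of_nonneg_right hr2.le hlog2.le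
    have h2 : t / β / 2 ≤ r * Real.log 2 := by linarith [neg_abs_le (Real.log L)]
    rw [div_div, div_le_iff₀ (by positivity)] at h2
    linarith
  have hup : (r : ℝ) ≤ 2 * t / (β * Real.log 2) := by
    rw [le_div_iff₀ (by positivity)]
    have h1 : r * Real.log 2 ≤ (y + 1) * Real.log 2 := mul_le_mul_of_nonneg_right hr1 hlog2.le
    have h2 : r * Real.log 2 ≤ 2 * t / β := by
      rw [mul_div_assoc]; linarith [le_abs_self (Real.log L)]
    rw [le_div_iff₀ hβ] at h2
    linarith
  have hplow := (lt_two_pow_rateLevel β hL hε).le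
  rw [← hr] at hplow
  have hpup : (2 : ℝ) ^ r ≤ 2 * (L * ε ^ (-1 / β)) := by
    have h1 : (2 : ℝ) ^ y = L * ε ^ (-1 / β) :=
      Real.rpow_logb (by norm_num) (by norm_num) (by positivity)
    rw [← h1, ← Real.rpow_natCast]
    refine (Real.rpow_le_rpow_of_exponent_le (by norm_num) hr1).trans (le_of_eq ?_)
    rw [Real.rpow_add (by norm_num), Real.rpow_one, mul_comm]
  have hε' : 0 < ε ^ (-1 / β) := by positivity
  rw [rate, habs]
  constructor
  · calc _ = (L * ε ^ (-1 / β)) * (t / (2 * β * Real.log 2)) := by ring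
      _ ≤ _ := mul_le_mul hplow hlow (by positivity) (by positivity)
  · calc _ ≤ 2 * (L * ε ^ (-1 / β)) * (2 * t / (β * Real.log 2)) :=
          mul_le_mul hpup hup (by positivity) (by positivity)
      _ = _ := by ring

/-! ### The three estimates -/

theorem measurableSet_levelSpan (r : ℕ) : MeasurableSet[borel L2T] (levelSpan r : Set L2T) := by
  have : FiniteDimensional ℝ (levelSpan r) :=
    FiniteDimensional.span_of_finite ℝ ((indexSet r).finite_toSet.image psiL2)
  borelize L2T
  exact IsClosed.measurableSet
    (Submodule.closed_of_finiteDimensional (levelSpan r))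

theorem prior_mem_levelSpan {Ω : Type*} {Z : ℕ+ → Ω → ℝ} {R : Ω → ℕ} {S : Ω → ℝ} {ω : Ω} {r : ℕ}
    (h : R ω ≤ r) : prior Z R S ω ∈ levelSpan r :=
  Submodule.smul_mem _ _ <| Submodule.sum_mem _ fun i hi => Submodule.smul_mem _ _ <|
    Submodule.subset_span ⟨i, mem_indexSet_iff.2 ((mem_indexSet_iff.1 hi).trans h), rfl⟩

theorem log_coveringNumber_levelSpan_le {r : ℕ} (hr : 1 ≤ r) (b₀ : L2T) {a ε : ℝ} (ha : 0 < a)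
    (hε : 0 < ε) :
    ENNReal.log (coveringNumber (fun f g : L2T => supNorm (f - g)) (a * ε)
        {b ∈ (levelSpan r : Set L2T) | ‖b - b₀‖ ≤ ε} : ℕ∞) ≤
      ((3 * (Real.log (48 / a + 3) + 1) * (2 ^ r * r) : ℝ) : EReal) := by
  have hr' : (1 : ℝ) ≤ r := by exact_mod_cast hr
  have h2r : (1 : ℝ) ≤ 2 ^ r := one_le_pow₀ (by norm_num)
  set N := ⌈12 * 2 ^ (r + 1) / a⌉₊ with hN
  have hcov := coveringNumber_levelSpan_le r b₀ ha hε
  rw [← hN] at hcov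
  have hcov' := ENNReal.log_monotone (ENat.toENNReal_mono hcov)
  refine hcov'.trans ?_
  have e : ((((2 * N + 1) ^ (2 ^ (r + 1) + 1) : ℕ) : ℕ∞) : ℝ≥0∞) =
      ENNReal.ofReal ((2 * (N : ℝ) + 1) ^ (2 ^ (r + 1) + 1)) := by
    rw [ENat.toENNReal_coe, ← ENNReal.ofReal_natCast]
    push_cast
    rfl
  rw [e, ENNReal.log_ofReal_of_pos (by positivity), EReal.coe_le_coe_iff, Real.log_pow]
  have hN' : 2 * (N : ℝ) + 1 ≤ (48 / a + 3) * 2 ^ r := by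
    have h1 : (N : ℝ) < 12 * 2 ^ (r + 1) / a + 1 := Nat.ceil_lt_add_one (by positivity)
    have h2 : 12 * 2 ^ (r + 1) / a = 24 / a * 2 ^ r := by rw [pow_succ]; ring
    have h3 : 48 / a * (2 : ℝ) ^ r = 2 * (24 / a * 2 ^ r) := by ring
    rw [h2] at h1
    rw [add_mul, h3]
    linarith
  have hlog0 : 0 ≤ Real.log (48 / a + 3) := Real.log_nonneg (by
    have : 0 < 48 / a := by positivity
    linarith)
  have hlog : Real.log (2 * (N : ℝ) + 1) ≤ (Real.log (48 / a + 3) + 1) * r := by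
    refine (Real.log_le_log (by positivity) hN').trans ?_
    rw [Real.log_mul (by positivity) (by positivity), Real.log_pow]
    have h1 : Real.log 2 ≤ 1 := by linarith [Real.log_two_lt_d9]
    have h2 : (r : ℝ) * Real.log 2 ≤ r * 1 := mul_le_mul_of_nonneg_left h1 (by linarith)
    have h3 := le_mul_of_one_le_right hlog0 hr'
    linarith
  push_cast
  calc ((2 : ℝ) ^ (r + 1) + 1) * Real.log (2 * N + 1)
      ≤ (3 * 2 ^ r) * ((Real.log (48 / a + 3) + 1) * r) := by
        refine mul_le_mul ?_ hlog (Real.log_nonneg ?_) (by positivity)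
        · rw [pow_succ]; linarith
        · linarith [Nat.cast_nonneg (α := ℝ) N]
    _ = _ := by ring

end FaberSchauder

theorem mainTheorem4 {Ω : Type*} [MeasurableSpace Ω] (P : Measure Ω) [IsProbabilityMeasure P]
    (Z : ℕ+ → Ω → ℝ) (R : Ω → ℕ) (S : Ω → ℝ)
    (hZ : ∀ i, Measurable (Z i)) (hR : Measurable R) (hS : Measurable S)
    (hGauss : IsGaussianProcess Z P) (hmean : ∀ i, ∫ ω, Z i ω ∂P = 0)
    (hindZ : IndepFun (fun ω i => Z i ω) (fun ω => (R ω, S ω)) P)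
    (hindRS : IndepFun R S P)
    (b₀ : FaberSchauder.L2T) (α β : ℝ) (hβ : 0 < β)
    (hb₀ : FaberSchauder.IsSmooth β b₀)
    (hcov : (0 < α ∧ FaberSchauder.CovA α (fun i i' => cov[Z i, Z i'; P])) ∨
      (α = 1 / 2 ∧ FaberSchauder.CovB (fun i i' => cov[Z i, Z i'; P])))
    (htrunc : FaberSchauder.TruncationCond P R)
    (hscale : FaberSchauder.ScalingCond P S α β)
    (ε : ℕ → ℝ) (hε : ∀ n, 0 < ε n) (hε0 : Tendsto ε atTop (𝓝 0)) :
    ∃ C₁ : ℝ, 0 < C₁ ∧ ∀ C₂ : ℝ, 0 < C₂ →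
      ∃ B : ℕ → Set FaberSchauder.L2T,
        (∀ n, MeasurableSet[borel FaberSchauder.L2T] (B n)) ∧
        (∀ n, ∃ r : ℕ, B n = (FaberSchauder.levelSpan r : Set FaberSchauder.L2T)) ∧
        ∀ a : ℝ, 0 < a → ∃ C₃ : ℝ, 0 < C₃ ∧ ∀ᶠ n in atTop,
          ((-C₁ * FaberSchauder.rate β (ε n) : ℝ) : EReal) ≤
              ENNReal.log (P {ω | FaberSchauder.supNorm (FaberSchauder.prior Z R S ω - b₀) <
                ENNReal.ofReal (ε n)}) ∧
          ENNReal.log (P {ω | FaberSchauder.prior Z R S ω ∉ B n}) ≤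
              ((-C₂ * FaberSchauder.rate β (ε n) : ℝ) : EReal) ∧
          ENNReal.log (FaberSchauder.coveringNumber
                (fun f g : FaberSchauder.L2T => FaberSchauder.supNorm (f - g)) (a * ε n)
                {b ∈ B n | ‖b - b₀‖ ≤ ε n} : ℕ∞) ≤
              ((C₃ * FaberSchauder.rate β (ε n) : ℝ) : EReal) := by
  have hεt : Tendsto ε atTop (𝓝[>] 0) :=
    tendsto_nhdsWithin_iff.2 ⟨hε0, Eventually.of_forall hε⟩
  have hlog2 : 0 < Real.log 2 := Real.log_pos (by norm_num)
  obtain ⟨K, D, hK, hD, hball⟩ := FaberSchauder.exists_exp_le_measure_ball hZ hR hS hGauss hmean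
    hindZ hindRS hβ hb₀ hcov htrunc hscale
  obtain ⟨d₁, _, hd₁, _, htr⟩ := htrunc
  -- with this constant, the uniform error `D 2^{-β r}` is below `ε n`
  set L₁ : ℝ := D ^ (1 / β) with hL₁
  have hL₁0 : 0 < L₁ := by positivity
  have hr₁ : Tendsto (fun n => FaberSchauder.rateLevel β L₁ (ε n)) atTop atTop :=
    (tendsto_add_atTop_nat 1).comp <| tendsto_nat_floor_atTop.comp <|
      (FaberSchauder.tendsto_logb_mul_rpow hβ hL₁0).comp hεt
  refine ⟨K * (4 * L₁ / (β * Real.log 2)), by positivity, fun C₂ hC₂ => ?_⟩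
  -- with this constant, `d₁ 2^r r` exceeds `C₂` times the rate
  set L₂ : ℝ := C₂ * (2 * β * Real.log 2) / d₁ with hL₂
  have hL₂0 : 0 < L₂ := by positivity
  refine ⟨fun n => FaberSchauder.levelSpan (FaberSchauder.rateLevel β L₂ (ε n)),
    fun n => FaberSchauder.measurableSet_levelSpan _, fun n => ⟨_, rfl⟩, fun a ha => ?_⟩
  have hc : 0 < 3 * (Real.log (48 / a + 3) + 1) := by
    have : 0 ≤ Real.log (48 / a + 3) := Real.log_nonneg (by
      have : 0 < 48 / a := by positivity
      linarith)
    linarith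
  refine ⟨3 * (Real.log (48 / a + 3) + 1) * (4 * L₂ / (β * Real.log 2)), by positivity, ?_⟩
  filter_upwards [hr₁.eventually hball,
    hεt.eventually (FaberSchauder.eventually_rateLevel_bounds hβ hL₁0),
    hεt.eventually (FaberSchauder.eventually_rateLevel_bounds hβ hL₂0)] with n hn h₁ h₂
  refine ⟨?_, ?_, ?_⟩
  · refine le_trans ?_ (ENNReal.log_monotone (hn.trans (measure_mono fun ω hω => ?_)))
    · rw [ENNReal.log_ofReal_of_pos (Real.exp_pos _), Real.log_exp, EReal.coe_le_coe_iff]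
      have := mul_le_mul_of_nonneg_left h₁.2 hK.le
      linarith
    · refine lt_of_le_of_lt hω ((ENNReal.ofReal_lt_ofReal_iff (hε n)).2 ?_)
      exact FaberSchauder.mul_rpow_rateLevel_lt hβ hD (hε n)
  · set r := FaberSchauder.rateLevel β L₂ (ε n)
    have hle : P {ω | FaberSchauder.prior Z R S ω ∉ (FaberSchauder.levelSpan r : Set _)} ≤
        ENNReal.ofReal (Real.exp (-d₁ * 2 ^ r * r)) := by
      refine (measure_mono (t := {ω | r < R ω}) fun ω hω => ?_).trans ?_
      · by_contra h
        exact hω (FaberSchauder.prior_mem_levelSpan (not_lt.1 h))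
      · rw [← ENNReal.ofReal_toReal (measure_ne_top P {ω | r < R ω})]
        exact ENNReal.ofReal_le_ofReal (htr r (FaberSchauder.one_le_rateLevel _ _ _)).1
    refine (ENNReal.log_monotone hle).trans ?_
    rw [ENNReal.log_ofReal_of_pos (Real.exp_pos _), Real.log_exp, EReal.coe_le_coe_iff]
    have h := mul_le_mul_of_nonneg_left h₂.1 hd₁.le
    have e : d₁ * (L₂ / (2 * β * Real.log 2) * FaberSchauder.rate β (ε n)) =
        C₂ * FaberSchauder.rate β (ε n) := by
      rw [hL₂]; field_simp
    rw [e] at h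
    linarith
  · refine (FaberSchauder.log_coveringNumber_levelSpan_le
      (FaberSchauder.one_le_rateLevel _ _ _) b₀ ha (hε n)).trans (EReal.coe_le_coe_iff.2 ?_)
    rw [mul_assoc (3 * (Real.log (48 / a + 3) + 1))]
    exact mul_le_mul_of_nonneg_left h₂.2 hc.le
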